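/- Identify a two-row Young diagram with the pair $(\lambda_1,\lambda_2)$, $\lambda_1\ge\lambda_2\ge 0$, of its row lengths. For a box $(i,j)$ of a Young diagram $Y$, the hook $h_Y(i,j)$ consists of $(i,j)$, the boxes of $Y$ to its right in row $i$ and the boxes of $Y$ below it in column $j$; removing the hook means deleting its boxes and moving every box $(i',j')$ with $i'>i$, $j'>j$ to $(i'-1,j'-1)$. Let $OH(Y)$ be the set of all diagrams obtained from $Y$ by removing one hook. The game MHRG$(m,n)$ is the following two-player impartial game under normal play. The starting position is the rectangle $Y_{m,n}$ with $m$ rows and $n$ columns, whose box $(i,j)$ carries the number $\min\{j-i+m,\,i-j+n\}$; every smaller diagram inherits these numbers. In a turn the player removes a hook $h$ from the current diagram; let $A$ be the multiset of the numbers in $h$. As long as the resulting diagram has a box whose hook has multiset of numbers $A$, the player must choose such a box and remove its hook; when there is no such box, the turn ends. The $\mathcal G$-value of a position is $\mathcal G(Y)=\operatorname{mex}\{\mathcal G(Z): Z \text{ an option of } Y\}$. In the Sato–Welter game (hook removing game) on Young diagrams, a turn removes exactly one hook. **Theorem.** Let $n=2n'$ with $n'\ge 1$, and let $\mathcal F$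 be the set of the diagrams $(\lambda_1,\lambda_2)$ with $n\ge\lambda_1\ge\lambda_2\ge0$. In MHRG$(2,n)$: 1. The set of positions reachable from $Y_{2,n}$ (including $Y_{2,n}$ itself) is $\{(\lambda_1,\lambda_2)\in\mathcal F : \lambda_1+\lambda_2\ne n\}$. 2. If $Y=(\lambda_1,\lambda_2)\in\mathcal F$ and $\lambda_1+\lambda_2<n$, then the set of options of $Y$ is $OH(Y)$. 3. If $Y=(\lambda_1,\lambda_2)\in\mathcal F$ and $\lambda_1+\lambda_2>n$, then the set of options of $Y$ is $\bigl(OH(Y)\setminus\{(\lambda_1',\lambda_2')\in\mathcal F:\lambda'_1+\lambda_2'=n\}\bigr)\cup\{(n-\lambda_2,\,n-\lambda_1)\}$. 4. If $Y=(\lambda_1,\lambda_2)\in\mathcal F$ and $\lambda_1+\lambda_2<n$, then $\mathcal G(Y)$ equals the $\mathcal G$-value of $Y$ in the Sato–Welter game. 5. The diagrams $Y=(\lambda_1,\lambda_2)\in\mathcal F$ with $\lambda_1+\lambda_2>n$ and $\mathcal G(Y)=0$, $1$, $2$, respectively, are exactly the following ones that lie in $\mathcal F$, where $i$ runs over all integers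 $i\ge0$: - If $n'\equiv0\pmod 4$: - value $0$: $(n'+1+4i,n'+4i)$, $(n'+2+4i,n'+1+4i)$; - value $1$: $(n'+2,n')$, $(n'+1,n'+1)$, $(n'+4+2i,n'+4+2i)$; - value $2$: $(n'+2,n'+2)$, $(n'+3,n')$, $(n'+4,n'+1)$, $(n'+7+4i,n'+6+4i)$, $(n'+8+4i,n'+7+4i)$. - If $n'\equiv1\pmod 4$: - value $0$: $(n'+2+4i,n'+1+4i)$, $(n'+3+4i,n'+2+4i)$; - value $1$: $(n'+2+2i,n'+2i)$; - value $2$: $(n'+1,n')$, $(n'+2,n'-1)$, $(n'+3,n'+1)$, $(n'+5+2i,n'+5+2i)$. - If $n'\equiv2\pmod 4$: - value $0$: $(n'+1+4i,n'+4i)$, $(n'+2+4i,n'+1+4i)$; - value $1$: $(n'+2+2i,n'+2+2i)$; - value $2$: $(n'+3+4i,n'+2+4i)$, $(n'+4+4i,n'+3+4i)$. - If $n'\equiv3\pmod 4$: - value $0$: $(n'+2+4i,n'+1+4i)$, $(n'+3+4i,n'+2+4i)$; - value $1$: $(n'+1+2i,n'+1+2i)$; - value $2$: $(n'+4+8i,n'+1+8i)$,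 $(n'+5+8i,n'+2+8i)$, $(n'+6+8i,n'+3+8i)$, $(n'+7+8i,n'+4+8i)$. -/

import Mathlib

/-! ### Impartial games (normal play) -/

/-- A short impartial game on a type `P` of positions: `move Y Z` says that `Z` is an option of `Y`.
Every position has finitely many options and there is no infinite play. -/
structure ImpartialGame (P : Type) where
  move : P → P → Prop
  finite_options : ∀ Y, {Z | move Y Z}.Finite
  wf : WellFounded (fun Z Y => move Y Z)

namespace ImpartialGame

variable {P : Type}

/-- The set of options of a position. -/
def options (g : ImpartialGame P) (Y : P) : Set P := {Z | g.move Y Z}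

/-- The positions to which there is a transition (a finite, possibly empty, sequence of moves)
from `S`. -/
def reachable (g : ImpartialGame P) (S : P) : Set P := {Y | Relation.ReflTransGen g.move S Y}

/-- Minimum excluded value of a (proper) subset of `ℕ`. -/
noncomputable def mex (T : Set ℕ) : ℕ := sInf Tᶜ

/-- The Grundy value, defined by recursion along the moves; see `grundy_eq`. -/
noncomputable def grundy (g : ImpartialGame P) : P → ℕ :=
  g.wf.fix fun Y ih => mex {k | ∃ (Z : P) (h : g.move Y Z), ih Z h = k}

theorem grundy_eq (g : ImpartialGame P) (Y : P) :
    g.grundy Y = mex (g.grundy '' g.options Y) := by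
  rw [grundy, WellFounded.fix_eq]
  congr 1
  ext k
  simp [options]

end ImpartialGame

/-! ### Young diagrams and hooks

Boxes are indexed from `0`: the box `(i, j)` is the one in row `i + 1` and column `j + 1`. -/

namespace YoungDiagram

/-- The rectangular Young diagram with `m` rows and `n` columns. -/
def rect (m n : ℕ) : YoungDiagram where
  cells := Finset.range m ×ˢ Finset.range n
  isLowerSet := by
    intro c d hdc hc
    have h := Prod.mk_le_mk.1 hdc
    simp only [Finset.coe_product, Finset.coe_range, Set.mem_prod, Set.mem_Iio] at hc ⊢
    exact ⟨lt_of_le_of_lt h.1 hc.1, lt_of_le_of_lt h.2 hc.2⟩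

/-- The Young diagram `(a, b)`, with `a` boxes in the first row and `b` boxes in the second. -/
def twoRow (a b : ℕ) (hab : b ≤ a) : YoungDiagram where
  cells := ({0} ×ˢ Finset.range a) ∪ ({1} ×ˢ Finset.range b)
  isLowerSet := by
    rintro ⟨c₁, c₂⟩ ⟨d₁, d₂⟩ hdc hc
    have h := Prod.mk_le_mk.1 hdc
    simp only [Finset.coe_union, Finset.coe_product, Finset.coe_singleton, Finset.coe_range,
      Set.mem_union, Set.mem_prod, Set.mem_singleton_iff, Set.mem_Iio] at hc ⊢
    omega

/-- The diagram `(n - λ₂, n - λ₁)`, where `λ₁` and `λ₂` are the lengths of the first two rows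
of `Y`. -/
def reflect (n : ℕ) (Y : YoungDiagram) : YoungDiagram :=
  twoRow (n - Y.rowLen 1) (n - Y.rowLen 0) (Nat.sub_le_sub_left (Y.rowLen_anti 0 1 zero_le_one) n)

/-- The hook of `Y` corresponding to the box `c`: the boxes of `Y` that are equal to `c`, or to the
right of `c` in its row, or below `c` in its column. -/
def hook (Y : YoungDiagram) (c : ℕ × ℕ) : Finset (ℕ × ℕ) :=
  Y.cells.filter fun d => (d.1 = c.1 ∧ c.2 ≤ d.2) ∨ (d.2 = c.2 ∧ c.1 ≤ d.1)

/-- The shift made when the hook at `c` is removed: a box strictly below and strictly to the right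
of `c` moves one step up and one step left; all other boxes stay. -/
def hookShift (c d : ℕ × ℕ) : ℕ × ℕ :=
  if c.1 < d.1 ∧ c.2 < d.2 then (d.1 - 1, d.2 - 1) else d

theorem mem_image_hookShift (Y : YoungDiagram) (c e : ℕ × ℕ) :
    e ∈ (Y.cells \ Y.hook c).image (hookShift c) ↔
      ((e.1 < c.1 ∨ e.2 < c.2) ∧ e ∈ Y) ∨
        ((c.1 ≤ e.1 ∧ c.2 ≤ e.2) ∧ (e.1 + 1, e.2 + 1) ∈ Y) := by
  obtain ⟨c₁, c₂⟩ := c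
  obtain ⟨e₁, e₂⟩ := e
  simp only [Finset.mem_image, Finset.mem_sdiff, hook, Finset.mem_filter, mem_cells, hookShift,
    Prod.exists]
  constructor
  · rintro ⟨d₁, d₂, ⟨hd, hn⟩, he⟩
    have hn' : ¬ ((d₁ = c₁ ∧ c₂ ≤ d₂) ∨ (d₂ = c₂ ∧ c₁ ≤ d₁)) := fun h => hn ⟨hd, h⟩
    split_ifs at he with h
    · obtain ⟨rfl, rfl⟩ := Prod.mk.inj he
      refine Or.inr ⟨by omega, ?_⟩
      rwa [Nat.sub_add_cancel (by omega), Nat.sub_add_cancel (by omega)]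
    · obtain ⟨rfl, rfl⟩ := Prod.mk.inj he
      exact Or.inl ⟨by omega, hd⟩
  · rintro (⟨h, he⟩ | ⟨h, he⟩)
    · refine ⟨e₁, e₂, ⟨he, fun hh => ?_⟩, if_neg (by omega)⟩
      omega
    · refine ⟨e₁ + 1, e₂ + 1, ⟨he, fun hh => ?_⟩, ?_⟩
      · omega
      · rw [if_pos (by omega)]
        simp

/-- The Young diagram obtained from `Y` by removing the hook corresponding to the box `c`: delete
the boxes of the hook, then shift the boxes below and to the right of `c`. -/
def removeHook (Y : YoungDiagram) (c : ℕ × ℕ) : YoungDiagram where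
  cells := (Y.cells \ Y.hook c).image (hookShift c)
  isLowerSet := by
    intro e f hfe he
    rw [Finset.mem_coe, mem_image_hookShift] at he ⊢
    have h₁ : f.1 ≤ e.1 := hfe.1
    have h₂ : f.2 ≤ e.2 := hfe.2
    rcases he with ⟨h, he⟩ | ⟨h, he⟩
    · exact Or.inl ⟨by omega, Y.up_left_mem h₁ h₂ he⟩
    · by_cases hf : f.1 < c.1 ∨ f.2 < c.2
      · exact Or.inl ⟨hf, Y.up_left_mem (by omega) (by omega) he⟩
      · exact Or.inr ⟨by omega, Y.up_left_mem (by omega) (by omega) he⟩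

theorem removeHook_le (Y : YoungDiagram) (c : ℕ × ℕ) : Y.removeHook c ≤ Y := by
  intro e he
  rcases (mem_image_hookShift Y c e).1 he with ⟨_, h⟩ | ⟨_, h⟩
  · exact h
  · exact Y.up_left_mem (Nat.le_succ _) (Nat.le_succ _) h

theorem card_removeHook_lt (Y : YoungDiagram) {c : ℕ × ℕ} (hc : c ∈ Y) :
    (Y.removeHook c).card < Y.card := by
  refine lt_of_le_of_lt Finset.card_image_le (Finset.card_lt_card ?_)
  refine Finset.ssubset_iff_subset_ne.2 ⟨Finset.sdiff_subset, fun h => ?_⟩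
  have hc' : c ∈ Y.cells \ Y.hook c := by rw [h]; exact hc
  exact (Finset.mem_sdiff.1 hc').2 (Finset.mem_filter.2 ⟨hc, Or.inl ⟨rfl, le_rfl⟩⟩)

theorem finite_le (Y : YoungDiagram) : {Z : YoungDiagram | Z ≤ Y}.Finite := by
  refine Set.Finite.of_finite_image (f := YoungDiagram.cells)
    (Y.cells.powerset.finite_toSet.subset ?_) ?_
  · rintro _ ⟨Z, hZ, rfl⟩
    exact Finset.mem_coe.2 (Finset.mem_powerset.2 hZ)
  · intro Z _ W _ h
    exact YoungDiagram.ext h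

/-- The set of all diagrams obtained from `Y` by removing one hook. -/
def hookRemovals (Y : YoungDiagram) : Set YoungDiagram := {Z | ∃ c ∈ Y, Z = Y.removeHook c}

end YoungDiagram

open YoungDiagram

/-- The (single) Hook Removing Game, that is, the Sato–Welter game: a move removes one hook. -/
def HRG : ImpartialGame YoungDiagram where
  move Y Z := Z ∈ Y.hookRemovals
  finite_options Y := Y.finite_le.subset (by
    rintro _ ⟨c, _, rfl⟩
    exact Y.removeHook_le c)
  wf := Subrelation.wf (r := InvImage (· < ·) YoungDiagram.card) (by
    rintro _ Y ⟨c, hc, rfl⟩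
    exact Y.card_removeHook_lt hc) (InvImage.wf _ Nat.lt_wfRel.wf)

namespace MHRG

/-- The multiset of the numbers in the boxes of `X`, for a numbering `α`. -/
def labels (α : ℕ × ℕ → ℕ) (X : Finset (ℕ × ℕ)) : Multiset ℕ := X.val.map α

/-- `ContinueTurn α A Y Z`: within one turn, given `Y` after at least one removed hook whose multiset of
numbers is `A`, the player can end the turn with `Z`. As long as there is a box whose hook has
the multiset of numbers `A`, the player must choose such a box and remove its hook. -/
inductive ContinueTurn (α : ℕ × ℕ → ℕ) (A : Multiset ℕ) : YoungDiagram → YoungDiagram → Prop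
  | finish (Y : YoungDiagram) (h : ∀ c ∈ Y, labels α (Y.hook c) ≠ A) : ContinueTurn α A Y Y
  | again (Y Z : YoungDiagram) (c : ℕ × ℕ) (hc : c ∈ Y) (h : labels α (Y.hook c) = A)
      (hZ : ContinueTurn α A (Y.removeHook c) Z) : ContinueTurn α A Y Z

/-- One turn of the Multiple Hook Removing Game with numbering `α`. -/
def Move (α : ℕ × ℕ → ℕ) (Y Z : YoungDiagram) : Prop :=
  ∃ c ∈ Y, ContinueTurn α (labels α (Y.hook c)) (Y.removeHook c) Z

theorem ContinueTurn.le {α : ℕ × ℕ → ℕ} {A : Multiset ℕ} {Y Z : YoungDiagram}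
    (h : ContinueTurn α A Y Z) : Z ≤ Y := by
  induction h with
  | finish Y h => exact le_rfl
  | again Y Z c hc h hZ ih => exact ih.trans (Y.removeHook_le c)

end MHRG

/-- The Multiple Hook Removing Game with numbering `α`. -/
def MHRG (α : ℕ × ℕ → ℕ) : ImpartialGame YoungDiagram where
  move := MHRG.Move α
  finite_options Y := Y.finite_le.subset (by
    rintro Z ⟨c, _, h⟩
    exact h.le.trans (Y.removeHook_le c))
  wf := Subrelation.wf (r := InvImage (· < ·) YoungDiagram.card) (by
    rintro Z Y ⟨c, hc, h⟩
    exact lt_of_le_of_lt (Finset.card_le_card h.le) (Y.card_removeHook_lt hc))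
    (InvImage.wf _ Nat.lt_wfRel.wf)

/-- The unimodal numbering `min {j - i + m, i - j + n}` of the boxes `(i, j)` of the `m × n`
rectangle. On these boxes no subtraction is truncated, and the value does not depend on whether
rows and columns are counted from `0` or from `1`. -/
def unimodal (m n : ℕ) (c : ℕ × ℕ) : ℕ := min (c.2 + m - c.1) (c.1 + n - c.2)

/-- The game `MHRG(m, n)`, whose starting position is `rect m n`. -/
def MHRGRect (m n : ℕ) : ImpartialGame YoungDiagram := MHRG (unimodal m n)

/-- The pairs `(λ₁, λ₂)` listed for the value `0`; here the parameter `p` is half of the number of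
columns. -/
def table0 (p : ℕ) : Set (ℕ × ℕ) :=
  match p % 4 with
  | 0 => {x | ∃ i : ℕ, x = (p + 1 + 4 * i, p + 4 * i) ∨ x = (p + 2 + 4 * i, p + 1 + 4 * i)}
  | 1 => {x | ∃ i : ℕ, x = (p + 2 + 4 * i, p + 1 + 4 * i) ∨ x = (p + 3 + 4 * i, p + 2 + 4 * i)}
  | 2 => {x | ∃ i : ℕ, x = (p + 1 + 4 * i, p + 4 * i) ∨ x = (p + 2 + 4 * i, p + 1 + 4 * i)}
  | _ => {x | ∃ i : ℕ, x = (p + 2 + 4 * i, p + 1 + 4 * i) ∨ x = (p + 3 + 4 * i, p + 2 + 4 * i)}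

/-- The pairs `(λ₁, λ₂)` listed for the value `1`. -/
def table1 (p : ℕ) : Set (ℕ × ℕ) :=
  match p % 4 with
  | 0 => {(p + 2, p), (p + 1, p + 1)} ∪ {x | ∃ i : ℕ, x = (p + 4 + 2 * i, p + 4 + 2 * i)}
  | 1 => {x | ∃ i : ℕ, x = (p + 2 + 2 * i, p + 2 * i)}
  | 2 => {x | ∃ i : ℕ, x = (p + 2 + 2 * i, p + 2 + 2 * i)}
  | _ => {x | ∃ i : ℕ, x = (p + 1 + 2 * i, p + 1 + 2 * i)}

/-- The pairs `(λ₁, λ₂)` listed for the value `2`. -/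
def table2 (p : ℕ) : Set (ℕ × ℕ) :=
  match p % 4 with
  | 0 => {(p + 2, p + 2), (p + 3, p), (p + 4, p + 1)} ∪
      {x | ∃ i : ℕ, x = (p + 7 + 4 * i, p + 6 + 4 * i) ∨ x = (p + 8 + 4 * i, p + 7 + 4 * i)}
  | 1 => {(p + 1, p), (p + 2, p - 1), (p + 3, p + 1)} ∪
      {x | ∃ i : ℕ, x = (p + 5 + 2 * i, p + 5 + 2 * i)}
  | 2 => {x | ∃ i : ℕ, x = (p + 3 + 4 * i, p + 2 + 4 * i) ∨ x = (p + 4 + 4 * i, p + 3 + 4 * i)}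
  | _ => {x | ∃ i : ℕ, x = (p + 4 + 8 * i, p + 1 + 8 * i) ∨ x = (p + 5 + 8 * i, p + 2 + 8 * i) ∨
      x = (p + 6 + 8 * i, p + 3 + 8 * i) ∨ x = (p + 7 + 8 * i, p + 4 + 8 * i)}

/-! Encode the diagram `(a, b)` by the beads `x = a + 1` and `y = b`. Removing a hook lowers one
bead to a free place. When a bead goes from `x` to `w`, the hook meets each of the diagonals `w, …,
x - 1` once, and its numbers are the values there of a unimodal function symmetric under `t ↦ n -
t`. The multiset therefore determines the interval up to reflection
(`runLabels_injective_up_to_reflection`). Hence a turn continues only if the other bead sits at the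
mirror image `n + 1 - w`. It is then forced down to `n + 1 - x`, the net effect being to reflect
both beads. Since `n + 1` is odd, no place is its own mirror image, and the turn stops there. This
gives `move_beads_iff`, from which options, reachable positions and the comparison with the
Sato–Welter game follow.

For the values `0, 1, 2` the candidate positions are guessed: nim-sum `k + 1` below the middle, the
tables above it. By `grundy_eq_iff_of_local` it suffices to check that no move joins two candidates
of the same value, and that a position with no candidate value up to `k` moves to a candidate for
`k`. For each `k` the candidate pairs form a perfect matching of all places. So lowering one bead
cannot lead from a pair to a pair, and the natural move to a pair lowers one bead to the partner of
the other. The only obstruction is a position where both partners lie too high; there the reflection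
leads to a pair (`pairing_reflect_of_stuck`). Matched places are at distance at most `4`, which
reduces this to residues modulo `4` and `8`. -/

namespace ImpartialGame

variable {P : Type}

/-! ### Grundy values from local conditions -/

theorem mex_notMem {T : Set ℕ} (hT : T.Finite) : mex T ∉ T :=
  Nat.sInf_mem hT.infinite_compl.nonempty

theorem mem_of_lt_mex {T : Set ℕ} {k : ℕ} (hk : k < mex T) : k ∈ T := by
  by_contra h
  exact Nat.notMem_of_lt_sInf hk h

theorem grundy_ne_of_move (g : ImpartialGame P) {Y Z : P} (h : g.move Y Z) :
    g.grundy Z ≠ g.grundy Y := by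
  intro he
  refine mex_notMem ((g.finite_options Y).image g.grundy) ?_
  have := g.grundy_eq Y
  rw [options] at this
  rw [← this, ← he]
  exact ⟨Z, h, rfl⟩

theorem exists_move_of_lt_grundy (g : ImpartialGame P) {Y : P} {k : ℕ} (hk : k < g.grundy Y) :
    ∃ Z, g.move Y Z ∧ g.grundy Z = k := by
  rw [grundy_eq] at hk
  exact mem_of_lt_mex hk

/-- A family of sets of positions `Q k`, for `k < K`, consists of the sets of positions of
Grundy value `k` as soon as it satisfies the local conditions of the Grundy function. -/
theorem grundy_eq_iff_of_local (g : ImpartialGame P) (D : Set P) (K : ℕ) (Q : ℕ → P → Prop)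
    (closed : ∀ Y ∈ D, ∀ Z, g.move Y Z → Z ∈ D)
    (disj : ∀ Y ∈ D, ∀ j k, j < k → k < K → Q j Y → ¬ Q k Y)
    (indep : ∀ Y ∈ D, ∀ k < K, Q k Y → ∀ Z, g.move Y Z → ¬ Q k Z)
    (absorb : ∀ Y ∈ D, ∀ k < K, (∀ j ≤ k, ¬ Q j Y) → ∃ Z, g.move Y Z ∧ Q k Z)
    (Y : P) (hY : Y ∈ D) (k : ℕ) (hk : k < K) : g.grundy Y = k ↔ Q k Y := by
  induction Y using g.wf.induction generalizing k with
  | _ Y ihY =>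
  -- The outer induction covers the options of `Y` for every value; the inner one covers the smaller
  -- values at `Y` itself.
  induction k using Nat.strong_induction_on with
  | _ k ihk =>
  constructor
  · intro hg
    by_contra hQ
    have hno : ∀ j ≤ k, ¬ Q j Y := by
      intro j hj hQj
      rcases hj.eq_or_lt with rfl | hlt
      · exact hQ hQj
      · have := (ihk j hlt (hlt.trans hk)).2 hQj
        omega
    obtain ⟨Z, hZ, hQZ⟩ := absorb Y hY k hk hno
    exact g.grundy_ne_of_move hZ (((ihY Z hZ (closed Y hY Z hZ) k hk).2 hQZ).trans hg.symm)
  · intro hQ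
    rcases lt_trichotomy (g.grundy Y) k with h | h | h
    · exact absurd hQ (disj Y hY _ k h hk ((ihk _ h (h.trans hk)).1 rfl))
    · exact h
    · obtain ⟨Z, hZ, hgZ⟩ := g.exists_move_of_lt_grundy h
      exact absurd ((ihY Z hZ (closed Y hY Z hZ) k hk).1 hgZ) (indep Y hY k hk hQ Z hZ)

end ImpartialGame

/-! ### Two-row diagrams as pairs of beads -/

namespace YoungDiagram

theorem mem_twoRow {a b : ℕ} {hab : b ≤ a} {c : ℕ × ℕ} :
    c ∈ twoRow a b hab ↔ (c.1 = 0 ∧ c.2 < a) ∨ (c.1 = 1 ∧ c.2 < b) := by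
  rw [← mem_cells]
  simp only [twoRow, Finset.mem_union, Finset.mem_product, Finset.mem_singleton, Finset.mem_range]

theorem mem_rect {m n : ℕ} {c : ℕ × ℕ} : c ∈ rect m n ↔ c.1 < m ∧ c.2 < n := by
  rw [← mem_cells]
  simp [rect, Finset.mem_product]

theorem rowLen_zero_twoRow {a b : ℕ} (hab : b ≤ a) : (twoRow a b hab).rowLen 0 = a := by
  refine eq_of_forall_lt_iff fun j => ?_
  rw [← mem_iff_lt_rowLen, mem_twoRow]
  simp

theorem rowLen_one_twoRow {a b : ℕ} (hab : b ≤ a) : (twoRow a b hab).rowLen 1 = b := by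
  refine eq_of_forall_lt_iff fun j => ?_
  rw [← mem_iff_lt_rowLen, mem_twoRow]
  simp

/-- The Young diagram with at most two rows whose beta-set is `{x, y}`, that is, the diagram
`(x - 1, y)` if `y < x`, and `(y - 1, x)` if `x < y`. -/
def beads (x y : ℕ) : YoungDiagram :=
  twoRow (max x y - 1) (min (max x y - 1) (min x y)) (min_le_left _ _)

theorem beads_comm (x y : ℕ) : beads x y = beads y x := by
  simp only [beads, max_comm, min_comm]

theorem mem_beads {x y : ℕ} (h : y < x) {c : ℕ × ℕ} :
    c ∈ beads x y ↔ (c.1 = 0 ∧ c.2 + 1 < x) ∨ (c.1 = 1 ∧ c.2 < y) := by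
  rw [beads, mem_twoRow]
  omega

theorem twoRow_eq_beads {a b : ℕ} (hab : b ≤ a) : twoRow a b hab = beads (a + 1) b := by
  ext c
  rw [mem_cells, mem_cells, mem_twoRow, mem_beads (by omega)]
  omega

theorem rowLen_zero_beads {x y : ℕ} (h : y < x) : (beads x y).rowLen 0 = x - 1 := by
  rw [beads, rowLen_zero_twoRow]
  omega

theorem rowLen_one_beads {x y : ℕ} (h : y < x) : (beads x y).rowLen 1 = y := by
  rw [beads, rowLen_one_twoRow]
  omega

theorem beads_rowLen {n : ℕ} {Y : YoungDiagram} (hY : Y ≤ rect 2 n) :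
    beads (Y.rowLen 0 + 1) (Y.rowLen 1) = Y := by
  ext ⟨i, j⟩
  have h01 := Y.rowLen_anti 0 1 zero_le_one
  rw [mem_cells, mem_cells, mem_beads (by omega)]
  constructor
  · rintro (⟨h1, h2⟩ | ⟨h1, h2⟩) <;> simp only at h1 h2 <;> subst h1 <;>
      rw [mem_iff_lt_rowLen] <;> omega
  · intro h
    have h2 := (mem_rect.1 (hY h)).1
    rw [mem_iff_lt_rowLen] at h
    rcases (by omega : i = 0 ∨ i = 1) with rfl | rfl
    · exact Or.inl ⟨rfl, by simpa using h⟩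
    · exact Or.inr ⟨rfl, h⟩

theorem beads_le_rect {n x y : ℕ} (hyx : y < x) (hx : x ≤ n + 1) : beads x y ≤ rect 2 n := by
  intro c hc
  have hc := (mem_beads hyx).1 hc
  exact mem_rect.2 (by omega)

theorem rowLen_zero_le_of_le_rect {n : ℕ} {Y : YoungDiagram} (hY : Y ≤ rect 2 n) :
    Y.rowLen 0 ≤ n := by
  by_contra! h
  exact lt_irrefl _ (mem_rect.1 (hY (mem_iff_lt_rowLen.2 h))).2

/-- The diagrams in the rectangle with two rows and `n` columns are those with a beta-set in
`{0, …, n + 1}`. -/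
theorem exists_eq_beads {n : ℕ} {Y : YoungDiagram} (hY : Y ≤ rect 2 n) :
    ∃ x y, y < x ∧ x ≤ n + 1 ∧ Y = beads x y :=
  ⟨Y.rowLen 0 + 1, Y.rowLen 1, Nat.lt_succ_of_le (Y.rowLen_anti 0 1 zero_le_one),
    Nat.succ_le_succ (rowLen_zero_le_of_le_rect hY), (beads_rowLen hY).symm⟩

theorem beads_le_rect_of_ne {n x y : ℕ} (hne : x ≠ y) (hx : x ≤ n + 1) (hy : y ≤ n + 1) :
    beads x y ≤ rect 2 n := by
  rcases hne.lt_or_gt with h | h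
  · rw [beads_comm]
    exact beads_le_rect h hy
  · exact beads_le_rect h hx

theorem rowLen_add_beads {x y : ℕ} (hne : x ≠ y) :
    (beads x y).rowLen 0 + (beads x y).rowLen 1 + 1 = x + y := by
  rcases hne.lt_or_gt with h | h
  · rw [beads_comm, rowLen_zero_beads h, rowLen_one_beads h]
    omega
  · rw [rowLen_zero_beads h, rowLen_one_beads h]
    omega

theorem reflect_beads {n x y : ℕ} (hyx : y < x) (hx : x ≤ n + 1) :
    (beads x y).reflect n = beads (n + 1 - x) (n + 1 - y) := by
  rw [reflect, twoRow_eq_beads, rowLen_zero_beads hyx, rowLen_one_beads hyx, beads_comm]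
  congr 1 <;> omega

/-- `H` is membership in the two diagrams written out in coordinates, so that each use becomes a
problem of linear arithmetic. -/
theorem beads_removeHook {x y i j : ℕ} (h : y < x) {u v : ℕ} (huv : v < u)
    (H : ∀ r s, ((r < i ∨ s < j) ∧ ((r = 0 ∧ s + 1 < x) ∨ (r = 1 ∧ s < y)) ∨
      (i ≤ r ∧ j ≤ s) ∧ ((r + 1 = 0 ∧ s + 1 + 1 < x) ∨ (r + 1 = 1 ∧ s + 1 < y))) ↔
      ((r = 0 ∧ s + 1 < u) ∨ (r = 1 ∧ s < v))) :
    (beads x y).removeHook (i, j) = beads u v := by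
  ext ⟨r, s⟩
  rw [removeHook, mem_image_hookShift, mem_cells, mem_beads h, mem_beads h, mem_beads huv]
  exact H r s

end YoungDiagram

/-! ### The numbers on a hook and the lowering of beads -/

namespace MHRG

/-- The multiset of the numbers on a rim hook of a two-row diagram in the rectangle with `n`
columns, when the removal of the hook lowers a bead from `x` to `w`. -/
def runLabels (n w x : ℕ) : Multiset ℕ := (Finset.Ico w x).val.map fun t => min (t + 1) (n + 1 - t)

/-- In both rows the number of a box depends only on its diagonal `t = c.2 + 1 - c.1`, as `min (t +
1) (n + 1 - t)`. It is thus enough that `X` meets exactly the diagonals from `w` to `x - 1`, once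
each. -/
theorem labels_unimodal_eq_runLabels (n w x : ℕ) (X : Finset (ℕ × ℕ)) (hX : ∀ c ∈ X, c.1 ≤ 1)
    (inj : ∀ c ∈ X, ∀ d ∈ X, c.2 + 1 - c.1 = d.2 + 1 - d.1 → c = d)
    (himg : ∀ t, (∃ c ∈ X, c.2 + 1 - c.1 = t) ↔ w ≤ t ∧ t < x) :
    labels (unimodal 2 n) X = runLabels n w x := by
  have h : X.image (fun c => c.2 + 1 - c.1) = Finset.Ico w x := by
    ext t
    rw [Finset.mem_image, himg, Finset.mem_Ico]
  rw [runLabels, ← h, Finset.image_val_of_injOn (fun c hc d hd => inj c hc d hd),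
    Multiset.map_map, labels]
  refine Multiset.map_congr rfl fun c hc => ?_
  have := hX c hc
  simp only [unimodal, Function.comp]
  omega

/-- The cardinality gives the length of the interval. A unimodal function attains its minimum at an
end of the interval, so the least label gives the distance to the nearer end of the range; length
and distance leave only the interval and its mirror image. -/
theorem runLabels_injective_up_to_reflection {n w x w' x' : ℕ} (hwx : w < x) (hx : x ≤ n + 1)
    (hwx' : w' < x') (hx' : x' ≤ n + 1) (h : runLabels n w x = runLabels n w' x') :
    (w' = w ∧ x' = x) ∨ (w' = n + 1 - x ∧ x' = n + 1 - w) := by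
  have hcard : x - w = x' - w' := by simpa [runLabels] using congrArg Multiset.card h
  -- The least label of the first run also occurs in the second, hence is at least the least label
  -- there. Applying this both ways gives equality.
  have key : ∀ {u v u' v' : ℕ}, u < v → v ≤ n + 1 → v' ≤ n + 1 →
      runLabels n u v = runLabels n u' v' → min (u' + 1) (n + 2 - v') ≤ min (u + 1) (n + 2 - v) := by
    intro u v u' v' huv hv hv' h
    obtain ⟨t, h1, h2, h3⟩ : ∃ t, u ≤ t ∧ t < v ∧
        min (t + 1) (n + 1 - t) = min (u + 1) (n + 2 - v) := by
      rcases le_total (u + 1) (n + 2 - v) with h | h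
      · exact ⟨u, le_rfl, huv, by omega⟩
      · exact ⟨v - 1, by omega, by omega, by omega⟩
    have hm : min (t + 1) (n + 1 - t) ∈ runLabels n u v :=
      Multiset.mem_map.2 ⟨t, Finset.mem_Ico.2 ⟨h1, h2⟩, rfl⟩
    rw [h, runLabels, Multiset.mem_map] at hm
    obtain ⟨s, hs, he⟩ := hm
    rw [Finset.mem_val, Finset.mem_Ico] at hs
    rw [← h3, ← he]
    omega
  have h1 := key hwx hx hx' h
  have h2 := key hwx' hx' hx h.symm
  omega

/-- The function `t ↦ min (t + 1) (n + 1 - t)` is invariant under `t ↦ n - t`. -/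
theorem runLabels_reflect {n w x : ℕ} (hx : x ≤ n + 1) :
    runLabels n (n + 1 - x) (n + 1 - w) = runLabels n w x := by
  have h : (Finset.Ico w x).image (fun t => n - t) = Finset.Ico (n + 1 - x) (n + 1 - w) := by
    ext t
    simp only [Finset.mem_image, Finset.mem_Ico]
    constructor
    · rintro ⟨s, hs, rfl⟩
      omega
    · intro ht
      exact ⟨n - t, by omega, by omega⟩
  rw [runLabels, ← h, Finset.image_val_of_injOn, Multiset.map_map, runLabels]
  · refine Multiset.map_congr rfl fun c hc => ?_
    rw [Finset.mem_val, Finset.mem_Ico] at hc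
    simp only [Function.comp]
    omega
  · intro s hs t ht hst
    rw [Finset.coe_Ico, Set.mem_Ico] at hs ht
    simp only at hst
    omega

theorem mem_hook_beads {x y : ℕ} (h : y < x) {c d : ℕ × ℕ} :
    d ∈ (beads x y).hook c ↔ ((d.1 = 0 ∧ d.2 + 1 < x) ∨ (d.1 = 1 ∧ d.2 < y)) ∧
      ((d.1 = c.1 ∧ c.2 ≤ d.2) ∨ (d.2 = c.2 ∧ c.1 ≤ d.1)) := by
  rw [hook, Finset.mem_filter, mem_cells, mem_beads h]

/-- Removing the hook of the box `(0, w)` with `w < y` lowers the larger bead `x` below `y`. -/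
theorem hook_beads_zero_of_lt (n : ℕ) {x y w : ℕ} (h : y < x) (hw : w < y) :
    labels (unimodal 2 n) ((beads x y).hook (0, w)) = runLabels n w x ∧
      (beads x y).removeHook (0, w) = beads w y := by
  constructor
  · refine labels_unimodal_eq_runLabels n w x _ ?_ ?_ ?_
    · rintro ⟨c₁, c₂⟩ hc
      rw [mem_hook_beads h] at hc
      simp only at hc ⊢
      omega
    · rintro ⟨c₁, c₂⟩ hc ⟨d₁, d₂⟩ hd hcd
      rw [mem_hook_beads h] at hc hd
      simp only [Prod.mk.injEq] at hc hd hcd ⊢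
      omega
    · intro t
      constructor
      · rintro ⟨⟨c₁, c₂⟩, hc, rfl⟩
        rw [mem_hook_beads h] at hc
        simp only at hc ⊢
        omega
      · intro ht
        by_cases htw : t = w
        · refine ⟨(1, w), (mem_hook_beads h).2 ⟨Or.inr ⟨rfl, hw⟩, Or.inr ⟨rfl, zero_le_one⟩⟩, ?_⟩
          simp [htw]
        · refine ⟨(0, t - 1), (mem_hook_beads h).2 ⟨Or.inl ⟨rfl, ?_⟩, Or.inl ⟨rfl, ?_⟩⟩, ?_⟩ <;>
            simp only <;> omega
  · rw [beads_comm w y]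
    exact beads_removeHook h hw fun r s => by omega

/-- Removing the hook of the box `(0, w - 1)` with `y < w` lowers the larger bead `x` to `w`. -/
theorem hook_beads_zero_of_gt (n : ℕ) {x y w : ℕ} (hw : y < w) (hwx : w < x) :
    labels (unimodal 2 n) ((beads x y).hook (0, w - 1)) = runLabels n w x ∧
      (beads x y).removeHook (0, w - 1) = beads w y := by
  have h := hw.trans hwx
  constructor
  · refine labels_unimodal_eq_runLabels n w x _ ?_ ?_ ?_
    · rintro ⟨c₁, c₂⟩ hc
      rw [mem_hook_beads h] at hc
      simp only at hc ⊢
      omega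
    · rintro ⟨c₁, c₂⟩ hc ⟨d₁, d₂⟩ hd hcd
      rw [mem_hook_beads h] at hc hd
      simp only [Prod.mk.injEq] at hc hd hcd ⊢
      omega
    · intro t
      constructor
      · rintro ⟨⟨c₁, c₂⟩, hc, rfl⟩
        rw [mem_hook_beads h] at hc
        simp only at hc ⊢
        omega
      · intro ht
        refine ⟨(0, t - 1), (mem_hook_beads h).2 ⟨Or.inl ⟨rfl, ?_⟩, Or.inl ⟨rfl, ?_⟩⟩, ?_⟩ <;>
          simp only <;> omega
  · exact beads_removeHook h hw fun r s => by omega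

/-- Removing the hook of the box `(1, w)` lowers the smaller bead `y` to `w`. -/
theorem hook_beads_one (n : ℕ) {x y w : ℕ} (h : y < x) (hw : w < y) :
    labels (unimodal 2 n) ((beads x y).hook (1, w)) = runLabels n w y ∧
      (beads x y).removeHook (1, w) = beads x w := by
  constructor
  · refine labels_unimodal_eq_runLabels n w y _ ?_ ?_ ?_
    · rintro ⟨c₁, c₂⟩ hc
      rw [mem_hook_beads h] at hc
      simp only at hc ⊢
      omega
    · rintro ⟨c₁, c₂⟩ hc ⟨d₁, d₂⟩ hd hcd
      rw [mem_hook_beads h] at hc hd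
      simp only [Prod.mk.injEq] at hc hd hcd ⊢
      omega
    · intro t
      constructor
      · rintro ⟨⟨c₁, c₂⟩, hc, rfl⟩
        rw [mem_hook_beads h] at hc
        simp only at hc ⊢
        omega
      · intro ht
        refine ⟨(1, t), (mem_hook_beads h).2 ⟨Or.inr ⟨rfl, ht.2⟩, Or.inl ⟨rfl, ht.1⟩⟩, ?_⟩
        simp
  · exact beads_removeHook h (hw.trans h) fun r s => by omega

/-- Every bead can be lowered to every free place by removing a hook. -/
theorem exists_hook_of_lower (n : ℕ) {x y w : ℕ} (hxy : x ≠ y) (hw : w < x) (hwy : w ≠ y) :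
    ∃ c ∈ beads x y, labels (unimodal 2 n) ((beads x y).hook c) = runLabels n w x ∧
      (beads x y).removeHook c = beads w y := by
  rcases hxy.lt_or_gt with h | h
  · rw [beads_comm x y, beads_comm w y]
    exact ⟨(1, w), (mem_beads h).2 (Or.inr ⟨rfl, hw⟩), hook_beads_one n h hw⟩
  · rcases hwy.lt_or_gt with hlt | hgt
    · exact ⟨(0, w), (mem_beads h).2 (Or.inl ⟨rfl, by simp only; omega⟩),
        hook_beads_zero_of_lt n h hlt⟩
    · exact ⟨(0, w - 1), (mem_beads h).2 (Or.inl ⟨rfl, by simp only; omega⟩),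
        hook_beads_zero_of_gt n hgt hw⟩

/-- Removing a hook lowers one of the two beads to a free place. -/
theorem exists_lower_of_mem (n : ℕ) {x y : ℕ} (hxy : x ≠ y) {c : ℕ × ℕ} (hc : c ∈ beads x y) :
    ∃ u v w, ((u = x ∧ v = y) ∨ (u = y ∧ v = x)) ∧ w < u ∧ w ≠ v ∧
      labels (unimodal 2 n) ((beads x y).hook c) = runLabels n w u ∧
      (beads x y).removeHook c = beads w v := by
  wlog h : y < x generalizing x y
  · rw [beads_comm] at hc
    obtain ⟨u, v, w, huv, H⟩ := this hxy.symm hc (by omega)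
    rw [beads_comm x y]
    exact ⟨u, v, w, huv.symm, H⟩
  obtain ⟨i, j⟩ := c
  rcases (mem_beads h).1 hc with ⟨hi, hj⟩ | ⟨hi, hj⟩
  · simp only at hi hj
    subst hi
    by_cases hjy : j < y
    · exact ⟨x, y, j, by simp, by omega, by omega, hook_beads_zero_of_lt n h hjy⟩
    · exact ⟨x, y, j + 1, by simp, hj, by omega,
        hook_beads_zero_of_gt n (w := j + 1) (by omega) hj⟩
  · simp only at hi hj
    subst hi
    refine ⟨y, x, j, by simp, hj, by omega, ?_⟩
    rw [beads_comm j x]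
    exact hook_beads_one n h hj

theorem mem_hookRemovals_beads {x y : ℕ} (hxy : x ≠ y) {Z : YoungDiagram} :
    Z ∈ (beads x y).hookRemovals ↔
      (∃ w < x, w ≠ y ∧ Z = beads w y) ∨ ∃ w < y, w ≠ x ∧ Z = beads w x := by
  constructor
  · rintro ⟨c, hc, rfl⟩
    obtain ⟨u, v, w, ⟨rfl, rfl⟩ | ⟨rfl, rfl⟩, h1, h2, -, h4⟩ := exists_lower_of_mem 0 hxy hc
    · exact Or.inl ⟨w, h1, h2, h4⟩
    · exact Or.inr ⟨w, h1, h2, h4⟩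
  · rintro (⟨w, h1, h2, rfl⟩ | ⟨w, h1, h2, rfl⟩)
    · obtain ⟨c, hc, -, h⟩ := exists_hook_of_lower 0 hxy h1 h2
      exact ⟨c, hc, h.symm⟩
    · obtain ⟨c, hc, -, h⟩ := exists_hook_of_lower 0 hxy.symm h1 h2
      rw [beads_comm] at hc h
      exact ⟨c, hc, h.symm⟩

/-! ### Turns of the game in terms of beads -/

theorem continueTurn_iff_eq {α : ℕ × ℕ → ℕ} {A : Multiset ℕ} {Y Z : YoungDiagram}
    (h : ∀ c ∈ Y, labels α (Y.hook c) ≠ A) : ContinueTurn α A Y Z ↔ Z = Y := by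
  constructor
  · intro hZ
    cases hZ with
    | finish => rfl
    | again _ _ c hc hA _ => exact absurd hA (h c hc)
  · rintro rfl
    exact .finish _ h

/-- After the bead `x` has been lowered to `w`, with the other bead `y` not at the mirror image of
`w`, there is no hook with the same numbers. -/
theorem labels_hook_ne_of_lowered {p x y w : ℕ} (hx : x ≤ 2 * p + 1) (hy : y ≤ 2 * p + 1)
    (hxy : x ≠ y) (hw : w < x) (hwy : w ≠ y) (hs : w + y ≠ 2 * p + 1) :
    ∀ c ∈ beads w y, labels (unimodal 2 (2 * p)) ((beads w y).hook c) ≠ runLabels (2 * p) w x := by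
  intro c hc he
  obtain ⟨u, v, z, huv, h1, h2, h3, -⟩ := exists_lower_of_mem (2 * p) hwy hc
  have := runLabels_injective_up_to_reflection hw hx h1 (by omega) (he.symm.trans h3)
  -- A repeated interval would need a bead at `x`, and there is none. The mirrored interval needs a
  -- bead at `2 * p + 1 - w`: this is not `w`, by parity, and not `y`, by `hs`.
  omega

/-- The end of a turn that starts with lowering the bead `x` to `w`. -/
theorem continueTurn_lowered_iff {p x y w : ℕ} (hx : x ≤ 2 * p + 1) (hy : y ≤ 2 * p + 1)
    (hxy : x ≠ y) (hs : x + y ≠ 2 * p + 1) (hw : w < x) (hwy : w ≠ y) {Z : YoungDiagram} :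
    ContinueTurn (unimodal 2 (2 * p)) (runLabels (2 * p) w x) (beads w y) Z ↔
      (w + y ≠ 2 * p + 1 ∧ Z = beads w y) ∨
        (w + y = 2 * p + 1 ∧ Z = beads (2 * p + 1 - x) (2 * p + 1 - y)) := by
  by_cases hwN : w + y = 2 * p + 1
  · have hend : ∀ c ∈ beads (2 * p + 1 - x) w,
        labels (unimodal 2 (2 * p)) ((beads (2 * p + 1 - x) w).hook c) ≠
          runLabels (2 * p) w x := by
      intro c hc he
      obtain ⟨u, v, z, huv, h1, h2, h3, -⟩ := exists_lower_of_mem (2 * p) (by omega) hc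
      have := runLabels_injective_up_to_reflection hw hx h1 (by omega) (he.symm.trans h3)
      omega
    have hw' : w = 2 * p + 1 - y := by omega
    have hrefl : runLabels (2 * p) (2 * p + 1 - x) y = runLabels (2 * p) w x := by
      rw [← runLabels_reflect hx]
      congr 1
      omega
    constructor
    · intro hZ
      refine Or.inr ⟨hwN, ?_⟩
      cases hZ with
      | finish _ h =>
        obtain ⟨c, hc, hl, -⟩ := exists_hook_of_lower (2 * p) (x := y) (y := w)
          (w := 2 * p + 1 - x) hwy.symm (by omega) (by omega)
        rw [beads_comm] at hc hl
        exact absurd (hl.trans hrefl) (h c hc)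
      | again _ _ c hc hA hZ =>
        obtain ⟨u, v, z, huv, h1, h2, h3, h4⟩ := exists_lower_of_mem (2 * p) hwy hc
        have := runLabels_injective_up_to_reflection hw hx h1 (by omega) (hA.symm.trans h3)
        obtain ⟨hz, hv⟩ : z = 2 * p + 1 - x ∧ v = w := by omega
        rw [h4, hz, hv, continueTurn_iff_eq hend] at hZ
        rw [hZ, ← hw']
    · rintro (⟨h, -⟩ | ⟨-, rfl⟩)
      · exact absurd hwN h
      · obtain ⟨c, hc, hl, hr⟩ := exists_hook_of_lower (2 * p) (x := y) (y := w)
          (w := 2 * p + 1 - x) hwy.symm (by omega) (by omega)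
        rw [beads_comm y w] at hc hl hr
        refine .again _ _ c hc (hl.trans hrefl) ?_
        rw [hr, continueTurn_iff_eq hend, ← hw']
  · rw [continueTurn_iff_eq (labels_hook_ne_of_lowered hx hy hxy hw hwy hwN)]
    simp [hwN]

/-- The moves of the game in terms of beads: lower one bead, keeping off the pairs of mirror
images, or reflect both beads if this makes their sum smaller. -/
theorem move_beads_iff {p x y : ℕ} (hx : x ≤ 2 * p + 1) (hy : y ≤ 2 * p + 1) (hxy : x ≠ y)
    (hs : x + y ≠ 2 * p + 1) {Z : YoungDiagram} :
    (MHRGRect 2 (2 * p)).move (beads x y) Z ↔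
      (∃ w < x, w ≠ y ∧ w + y ≠ 2 * p + 1 ∧ Z = beads w y) ∨
      (∃ w < y, w ≠ x ∧ w + x ≠ 2 * p + 1 ∧ Z = beads w x) ∨
      (2 * p + 1 < x + y ∧ Z = beads (2 * p + 1 - x) (2 * p + 1 - y)) := by
  constructor
  · rintro ⟨c, hc, hZ⟩
    obtain ⟨u, v, w, ⟨rfl, rfl⟩ | ⟨rfl, rfl⟩, h1, h2, h3, h4⟩ :=
      exists_lower_of_mem (2 * p) hxy hc
    · rw [h3, h4, continueTurn_lowered_iff hx hy hxy hs h1 h2] at hZ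
      rcases hZ with ⟨h, hZ⟩ | ⟨h, hZ⟩
      · exact Or.inl ⟨w, h1, h2, h, hZ⟩
      · exact Or.inr (Or.inr ⟨by omega, hZ⟩)
    · rw [h3, h4, continueTurn_lowered_iff hy hx hxy.symm (by omega) h1 h2] at hZ
      rcases hZ with ⟨h, hZ⟩ | ⟨h, hZ⟩
      · exact Or.inr (Or.inl ⟨w, h1, h2, h, hZ⟩)
      · exact Or.inr (Or.inr ⟨by omega, by rw [hZ, beads_comm]⟩)
  · rintro (⟨w, h1, h2, h3, rfl⟩ | ⟨w, h1, h2, h3, rfl⟩ | ⟨h, rfl⟩)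
    · obtain ⟨c, hc, hl, hr⟩ := exists_hook_of_lower (2 * p) hxy h1 h2
      refine ⟨c, hc, ?_⟩
      rw [hl, hr, continueTurn_lowered_iff hx hy hxy hs h1 h2]
      exact Or.inl ⟨h3, rfl⟩
    · obtain ⟨c, hc, hl, hr⟩ := exists_hook_of_lower (2 * p) hxy.symm h1 h2
      rw [beads_comm y x] at hc hl hr
      refine ⟨c, hc, ?_⟩
      rw [hl, hr, continueTurn_lowered_iff hy hx hxy.symm (by omega) h1 h2]
      exact Or.inl ⟨h3, rfl⟩
    · have h1 : 2 * p + 1 - y < x := by omega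
      -- Parity is essential here: the mirror image of `y` is free because `2 * p + 1` is odd.
      have h2 : 2 * p + 1 - y ≠ y := by omega
      obtain ⟨c, hc, hl, hr⟩ := exists_hook_of_lower (2 * p) hxy h1 h2
      refine ⟨c, hc, ?_⟩
      rw [hl, hr, continueTurn_lowered_iff hx hy hxy hs h1 h2]
      exact Or.inr ⟨by omega, rfl⟩

/-! ### The candidate pairs for the values 0, 1 and 2 -/

/-- The pairs of beads `y < x` with sum less than `2 * p + 1` whose position has value `k`, for
`k < 3`: those with nim-sum `k + 1`. -/
def lowPair (k x y : ℕ) : Prop :=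
  match k with
  | 0 => x = y + 1 ∧ y % 2 = 0
  | 1 => x = y + 2 ∧ y % 4 < 2
  | _ => (x = y + 3 ∧ y % 4 = 0) ∨ (x = y + 1 ∧ y % 4 = 1)

/-- The pairs of beads `y < x` with sum greater than `2 * p + 1` whose position has value `k`, for
`k < 3`. -/
def highPair (p k x y : ℕ) : Prop :=
  match p % 4, k with
  | 0, 0 => x = y + 2 ∧ p ≤ y ∧ (y - p) % 4 < 2
  | 0, 1 => (x = p + 3 ∧ y = p) ∨ (x = p + 2 ∧ y = p + 1) ∨
      (x = y + 1 ∧ p + 4 ≤ y ∧ (y - p) % 2 = 0)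
  | 0, _ => (x = p + 3 ∧ y = p + 2) ∨ (x = p + 4 ∧ y = p) ∨ (x = p + 5 ∧ y = p + 1) ∨
      (x = y + 2 ∧ p + 6 ≤ y ∧ 2 ≤ (y - p) % 4)
  | 1, 0 => x = y + 2 ∧ p + 1 ≤ y ∧ (y - (p + 1)) % 4 < 2
  | 1, 1 => x = y + 3 ∧ p ≤ y ∧ (y - p) % 2 = 0
  | 1, _ => (x = p + 2 ∧ y = p) ∨ (x = p + 3 ∧ y + 1 = p) ∨ (x = p + 4 ∧ y = p + 1) ∨
      (x = y + 1 ∧ p + 5 ≤ y ∧ (y - p) % 2 = 1)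
  | 2, 0 => x = y + 2 ∧ p ≤ y ∧ (y - p) % 4 < 2
  | 2, 1 => x = y + 1 ∧ p + 2 ≤ y ∧ (y - p) % 2 = 0
  | 2, _ => x = y + 2 ∧ p + 2 ≤ y ∧ 2 ≤ (y - p) % 4
  | _, 0 => x = y + 2 ∧ p + 1 ≤ y ∧ (y - (p + 1)) % 4 < 2
  | _, 1 => x = y + 1 ∧ p + 1 ≤ y ∧ (y - p) % 2 = 1
  | _, _ => x = y + 4 ∧ p + 1 ≤ y ∧ (y - (p + 1)) % 8 < 4

/-- The pairs of beads `y < x` whose position has value `k`, for `k < 3`. -/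
def pairing (p k x y : ℕ) : Prop :=
  (x + y < 2 * p + 1 ∧ lowPair k x y) ∨ (2 * p + 1 < x + y ∧ highPair p k x y)

theorem mod_four_cases (p : ℕ) : p % 4 = 0 ∨ p % 4 = 1 ∨ p % 4 = 2 ∨ p % 4 = 3 := by omega

theorem pairing_lt {p k x y : ℕ} (h : pairing p k x y) : y < x := by
  rcases (by omega : k = 0 ∨ k = 1 ∨ 2 ≤ k) with rfl | rfl | hk
  · rcases mod_four_cases p with hp | hp | hp | hp <;>
    simp only [pairing, lowPair, highPair, hp] at h <;> omega
  · rcases mod_four_cases p with hp | hp | hp | hp <;>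
    simp only [pairing, lowPair, highPair, hp] at h <;> omega
  · obtain ⟨k, rfl⟩ : ∃ l, k = l + 2 := ⟨k - 2, by omega⟩
    rcases mod_four_cases p with hp | hp | hp | hp <;>
    simp only [pairing, lowPair, highPair, hp] at h <;> omega

theorem pairing_disjoint {p j k x y : ℕ} (hjk : j < k) (hk : k < 3) (hj : pairing p j x y) :
    ¬ pairing p k x y := by
  intro h
  rcases (by omega : (j = 0 ∧ k = 1) ∨ (j = 0 ∧ k = 2) ∨ (j = 1 ∧ k = 2)) with
    ⟨rfl, rfl⟩ | ⟨rfl, rfl⟩ | ⟨rfl, rfl⟩ <;>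
  rcases mod_four_cases p with hp | hp | hp | hp <;>
  simp only [pairing, lowPair, highPair, hp] at h hj <;> omega

/-- Reflection preserves the gap `x - y`. For `k = 0, 1` the gaps of low and high pairs differ; for
`k = 2` they can agree only when `p % 4` is `0` or `1`, and then the residue of the smaller bead
modulo `4` rules it out. -/
theorem pairing_reflect {p k x y : ℕ} (hk : k < 3) (hx : x ≤ 2 * p + 1) (hs : 2 * p + 1 < x + y)
    (h : pairing p k x y) : ¬ pairing p k (2 * p + 1 - y) (2 * p + 1 - x) := by
  intro h'
  rcases (by omega : k = 0 ∨ k = 1 ∨ k = 2) with rfl | rfl | rfl <;>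
  rcases mod_four_cases p with hp | hp | hp | hp <;>
  simp only [pairing, lowPair, highPair, hp] at h h' <;> omega

/-- Together with `pairing_unique_right`, `not_pairing_of_pairing` and `exists_partner`, this makes
the pairs for a fixed `k` a perfect matching of `ℕ`. -/
theorem pairing_unique_left {p k x y y' : ℕ} (hk : k < 3) (h : pairing p k x y)
    (h' : pairing p k x y') : y = y' := by
  rcases (by omega : k = 0 ∨ k = 1 ∨ k = 2) with rfl | rfl | rfl <;>
  rcases mod_four_cases p with hp | hp | hp | hp <;>
  simp only [pairing, lowPair, highPair, hp] at h h' <;> omega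

theorem pairing_unique_right {p k x x' y : ℕ} (hk : k < 3) (h : pairing p k x y)
    (h' : pairing p k x' y) : x = x' := by
  rcases (by omega : k = 0 ∨ k = 1 ∨ k = 2) with rfl | rfl | rfl <;>
  rcases mod_four_cases p with hp | hp | hp | hp <;>
  simp only [pairing, lowPair, highPair, hp] at h h' <;> omega

theorem not_pairing_of_pairing {p k x y z : ℕ} (hk : k < 3) (h : pairing p k x y) :
    ¬ pairing p k y z := by
  intro h'
  rcases (by omega : k = 0 ∨ k = 1 ∨ k = 2) with rfl | rfl | rfl <;>
  rcases mod_four_cases p with hp | hp | hp | hp <;>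
  simp only [pairing, lowPair, highPair, hp] at h h' <;> omega

end MHRG

/-! ### The tables in terms of beads -/

theorem mem_table0_iff {p x y : ℕ} (hyx : y < x) :
    (x - 1, y) ∈ table0 p ↔ MHRG.highPair p 0 x y := by
  rcases MHRG.mod_four_cases p with hp | hp | hp | hp <;>
  simp only [table0, MHRG.highPair, hp, Set.mem_ofPred_eq, Prod.mk.injEq] <;>
  -- The second entries exceed `p + 4 * i` by at most `2`, so one quotient serves both families.
  refine ⟨fun ⟨i, h⟩ => by omega, fun h => ⟨(y - p) / 4, by omega⟩⟩

theorem mem_table1_iff {p x y : ℕ} (hyx : y < x) :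
    (x - 1, y) ∈ table1 p ↔ MHRG.highPair p 1 x y := by
  rcases MHRG.mod_four_cases p with hp | hp | hp | hp <;>
  simp only [table1, MHRG.highPair, hp, Set.mem_union, Set.mem_insert_iff,
    Set.mem_singleton_iff, Set.mem_ofPred_eq, Prod.mk.injEq]
  · constructor
    · rintro (h | ⟨i, h⟩) <;> omega
    · intro h
      by_cases hy : p + 4 ≤ y
      · exact Or.inr ⟨(y - (p + 4)) / 2, by omega⟩
      · exact Or.inl (by omega)
  · exact ⟨fun ⟨i, h⟩ => by omega, fun h => ⟨(y - p) / 2, by omega⟩⟩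
  · exact ⟨fun ⟨i, h⟩ => by omega, fun h => ⟨(y - (p + 2)) / 2, by omega⟩⟩
  · exact ⟨fun ⟨i, h⟩ => by omega, fun h => ⟨(y - (p + 1)) / 2, by omega⟩⟩

theorem mem_table2_iff {p x y : ℕ} (hyx : y < x) :
    (x - 1, y) ∈ table2 p ↔ MHRG.highPair p 2 x y := by
  rcases MHRG.mod_four_cases p with hp | hp | hp | hp <;>
  simp only [table2, MHRG.highPair, hp, Set.mem_union, Set.mem_insert_iff,
    Set.mem_singleton_iff, Set.mem_ofPred_eq, Prod.mk.injEq]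
  · constructor
    · rintro (h | ⟨i, h⟩) <;> omega
    · intro h
      by_cases hy : p + 6 ≤ y
      · exact Or.inr ⟨(y - (p + 6)) / 4, by omega⟩
      · exact Or.inl (by omega)
  · constructor
    · rintro (h | ⟨i, h⟩) <;> omega
    · intro h
      by_cases hy : p + 5 ≤ y
      · exact Or.inr ⟨(y - (p + 5)) / 2, by omega⟩
      · exact Or.inl (by omega)
  · exact ⟨fun ⟨i, h⟩ => by omega, fun h => ⟨(y - (p + 2)) / 4, by omega⟩⟩
  · exact ⟨fun ⟨i, h⟩ => by omega, fun h => ⟨(y - (p + 1)) / 8, by omega⟩⟩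

/-! ### Existence of partners, and stuck positions -/

namespace MHRG

theorem exists_partner_zero (p z : ℕ) : ∃ w, pairing p 0 z w ∨ pairing p 0 w z := by
  rcases mod_four_cases p with hp | hp | hp | hp <;>
  simp only [pairing, lowPair, highPair, hp]
  · rcases (by omega : (z < p ∧ z % 2 = 0) ∨ (z < p ∧ z % 2 = 1) ∨ (p ≤ z ∧ (z - p) % 4 < 2) ∨
      (p ≤ z ∧ 2 ≤ (z - p) % 4)) with
      h | h | h | h
    · exact ⟨z + 1, Or.inr (Or.inl (by omega))⟩
    · exact ⟨z - 1, Or.inl (Or.inl (by omega))⟩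
    · exact ⟨z + 2, Or.inr (Or.inr (by omega))⟩
    · exact ⟨z - 2, Or.inl (Or.inr (by omega))⟩
  · rcases (by omega : (z ≤ p ∧ z % 2 = 0) ∨ (z ≤ p ∧ z % 2 = 1) ∨
      (p < z ∧ (z - (p + 1)) % 4 < 2) ∨ (p < z ∧ 2 ≤ (z - (p + 1)) % 4)) with
      h | h | h | h
    · exact ⟨z + 1, Or.inr (Or.inl (by omega))⟩
    · exact ⟨z - 1, Or.inl (Or.inl (by omega))⟩
    · exact ⟨z + 2, Or.inr (Or.inr (by omega))⟩
    · exact ⟨z - 2, Or.inl (Or.inr (by omega))⟩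
  · rcases (by omega : (z < p ∧ z % 2 = 0) ∨ (z < p ∧ z % 2 = 1) ∨ (p ≤ z ∧ (z - p) % 4 < 2) ∨
      (p ≤ z ∧ 2 ≤ (z - p) % 4)) with
      h | h | h | h
    · exact ⟨z + 1, Or.inr (Or.inl (by omega))⟩
    · exact ⟨z - 1, Or.inl (Or.inl (by omega))⟩
    · exact ⟨z + 2, Or.inr (Or.inr (by omega))⟩
    · exact ⟨z - 2, Or.inl (Or.inr (by omega))⟩
  · rcases (by omega : (z ≤ p ∧ z % 2 = 0) ∨ (z ≤ p ∧ z % 2 = 1) ∨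
      (p < z ∧ (z - (p + 1)) % 4 < 2) ∨ (p < z ∧ 2 ≤ (z - (p + 1)) % 4)) with
      h | h | h | h
    · exact ⟨z + 1, Or.inr (Or.inl (by omega))⟩
    · exact ⟨z - 1, Or.inl (Or.inl (by omega))⟩
    · exact ⟨z + 2, Or.inr (Or.inr (by omega))⟩
    · exact ⟨z - 2, Or.inl (Or.inr (by omega))⟩

theorem exists_partner_one (p z : ℕ) : ∃ w, pairing p 1 z w ∨ pairing p 1 w z := by
  rcases mod_four_cases p with hp | hp | hp | hp <;>
  simp only [pairing, lowPair, highPair, hp]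
  · rcases (by omega : (z < p ∧ z % 4 < 2) ∨ (z < p ∧ 2 ≤ z % 4) ∨ z = p ∨ z = p + 3 ∨
      z = p + 1 ∨ z = p + 2 ∨ (p + 4 ≤ z ∧ z % 2 = 0) ∨ (p + 4 ≤ z ∧ z % 2 = 1)) with
      h | h | h | h | h | h | h | h
    · exact ⟨z + 2, Or.inr (Or.inl (by omega))⟩
    · exact ⟨z - 2, Or.inl (Or.inl (by omega))⟩
    · exact ⟨z + 3, Or.inr (Or.inr (by omega))⟩
    · exact ⟨z - 3, Or.inl (Or.inr (by omega))⟩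
    · exact ⟨z + 1, Or.inr (Or.inr (by omega))⟩
    · exact ⟨z - 1, Or.inl (Or.inr (by omega))⟩
    · exact ⟨z + 1, Or.inr (Or.inr (by omega))⟩
    · exact ⟨z - 1, Or.inl (Or.inr (by omega))⟩
  · rcases (by omega : (z < p ∧ z % 4 < 2) ∨ ((z < p ∨ z = p + 1) ∧ 2 ≤ z % 4) ∨
      (p ≤ z ∧ z % 2 = 1) ∨ (p + 2 ≤ z ∧ z % 2 = 0)) with
      h | h | h | h
    · exact ⟨z + 2, Or.inr (Or.inl (by omega))⟩
    · exact ⟨z - 2, Or.inl (Or.inl (by omega))⟩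
    · exact ⟨z + 3, Or.inr (Or.inr (by omega))⟩
    · exact ⟨z - 3, Or.inl (Or.inr (by omega))⟩
  · rcases (by omega : (z ≤ p + 1 ∧ z % 4 < 2) ∨ (z ≤ p + 1 ∧ 2 ≤ z % 4) ∨
      (p + 2 ≤ z ∧ z % 2 = 0) ∨ (p + 2 ≤ z ∧ z % 2 = 1)) with
      h | h | h | h
    · exact ⟨z + 2, Or.inr (Or.inl (by omega))⟩
    · exact ⟨z - 2, Or.inl (Or.inl (by omega))⟩
    · exact ⟨z + 1, Or.inr (Or.inr (by omega))⟩
    · exact ⟨z - 1, Or.inl (Or.inr (by omega))⟩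
  · rcases (by omega : (z ≤ p ∧ z % 4 < 2) ∨ (z ≤ p ∧ 2 ≤ z % 4) ∨ (p + 1 ≤ z ∧ z % 2 = 0) ∨
      (p + 1 ≤ z ∧ z % 2 = 1)) with
      h | h | h | h
    · exact ⟨z + 2, Or.inr (Or.inl (by omega))⟩
    · exact ⟨z - 2, Or.inl (Or.inl (by omega))⟩
    · exact ⟨z + 1, Or.inr (Or.inr (by omega))⟩
    · exact ⟨z - 1, Or.inl (Or.inr (by omega))⟩

theorem exists_partner_two (p z : ℕ) : ∃ w, pairing p 2 z w ∨ pairing p 2 w z := by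
  rcases mod_four_cases p with hp | hp | hp | hp <;>
  simp only [pairing, lowPair, highPair, hp]
  · rcases (by omega : (z < p ∧ z % 4 = 0) ∨ (z < p ∧ z % 4 = 3) ∨ (z < p ∧ z % 4 = 1) ∨
      (z < p ∧ z % 4 = 2) ∨ (z = p ∨ z = p + 1) ∨ (z = p + 4 ∨ z = p + 5) ∨ z = p + 2 ∨
      z = p + 3 ∨ (p + 6 ≤ z ∧ 2 ≤ z % 4) ∨ (p + 6 ≤ z ∧ z % 4 < 2)) with
      h | h | h | h | h | h | h | h | h | h
    · exact ⟨z + 3, Or.inr (Or.inl (by omega))⟩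
    · exact ⟨z - 3, Or.inl (Or.inl (by omega))⟩
    · exact ⟨z + 1, Or.inr (Or.inl (by omega))⟩
    · exact ⟨z - 1, Or.inl (Or.inl (by omega))⟩
    · exact ⟨z + 4, Or.inr (Or.inr (by omega))⟩
    · exact ⟨z - 4, Or.inl (Or.inr (by omega))⟩
    · exact ⟨z + 1, Or.inr (Or.inr (by omega))⟩
    · exact ⟨z - 1, Or.inl (Or.inr (by omega))⟩
    · exact ⟨z + 2, Or.inr (Or.inr (by omega))⟩
    · exact ⟨z - 2, Or.inl (Or.inr (by omega))⟩
  · rcases (by omega : (z + 1 < p ∧ z % 4 = 0) ∨ (z + 1 < p ∧ z % 4 = 3) ∨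
      (z + 1 < p ∧ z % 4 = 1) ∨ (z + 1 < p ∧ z % 4 = 2) ∨ z + 1 = p ∨ z = p + 3 ∨ z = p ∨
      z = p + 2 ∨ z = p + 1 ∨ z = p + 4 ∨ (p + 5 ≤ z ∧ z % 2 = 0) ∨ (p + 5 ≤ z ∧ z % 2 = 1)) with
      h | h | h | h | h | h | h | h | h | h | h | h
    · exact ⟨z + 3, Or.inr (Or.inl (by omega))⟩
    · exact ⟨z - 3, Or.inl (Or.inl (by omega))⟩
    · exact ⟨z + 1, Or.inr (Or.inl (by omega))⟩
    · exact ⟨z - 1, Or.inl (Or.inl (by omega))⟩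
    · exact ⟨z + 4, Or.inr (Or.inr (by omega))⟩
    · exact ⟨z - 4, Or.inl (Or.inr (by omega))⟩
    · exact ⟨z + 2, Or.inr (Or.inr (by omega))⟩
    · exact ⟨z - 2, Or.inl (Or.inr (by omega))⟩
    · exact ⟨z + 3, Or.inr (Or.inr (by omega))⟩
    · exact ⟨z - 3, Or.inl (Or.inr (by omega))⟩
    · exact ⟨z + 1, Or.inr (Or.inr (by omega))⟩
    · exact ⟨z - 1, Or.inl (Or.inr (by omega))⟩
  · rcases (by omega : (z ≤ p + 1 ∧ z % 4 = 0) ∨ (z ≤ p + 1 ∧ z % 4 = 3) ∨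
      (z ≤ p + 1 ∧ z % 4 = 1) ∨ (z ≤ p + 1 ∧ z % 4 = 2) ∨ (p + 2 ≤ z ∧ z % 4 < 2) ∨
      (p + 2 ≤ z ∧ 2 ≤ z % 4)) with
      h | h | h | h | h | h
    · exact ⟨z + 3, Or.inr (Or.inl (by omega))⟩
    · exact ⟨z - 3, Or.inl (Or.inl (by omega))⟩
    · exact ⟨z + 1, Or.inr (Or.inl (by omega))⟩
    · exact ⟨z - 1, Or.inl (Or.inl (by omega))⟩
    · exact ⟨z + 2, Or.inr (Or.inr (by omega))⟩
    · exact ⟨z - 2, Or.inl (Or.inr (by omega))⟩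
  · rcases (by omega : (z ≤ p ∧ z % 4 = 0) ∨ (z ≤ p ∧ z % 4 = 3) ∨ (z ≤ p ∧ z % 4 = 1) ∨
      (z ≤ p ∧ z % 4 = 2) ∨ (p + 1 ≤ z ∧ (z - (p + 1)) % 8 < 4) ∨
      (p + 1 ≤ z ∧ 4 ≤ (z - (p + 1)) % 8)) with
      h | h | h | h | h | h
    · exact ⟨z + 3, Or.inr (Or.inl (by omega))⟩
    · exact ⟨z - 3, Or.inl (Or.inl (by omega))⟩
    · exact ⟨z + 1, Or.inr (Or.inl (by omega))⟩
    · exact ⟨z - 1, Or.inl (Or.inl (by omega))⟩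
    · exact ⟨z + 4, Or.inr (Or.inr (by omega))⟩
    · exact ⟨z - 4, Or.inl (Or.inr (by omega))⟩

/-- Places are not bounded by the rectangle: a partner beyond `2 * p + 1` simply counts as one that
is too high to be reached. -/
theorem exists_partner {k : ℕ} (hk : k < 3) (p z : ℕ) :
    ∃ w, pairing p k z w ∨ pairing p k w z := by
  rcases (by omega : k = 0 ∨ k = 1 ∨ k = 2) with rfl | rfl | rfl
  · exact exists_partner_zero p z
  · exact exists_partner_one p z
  · exact exists_partner_two p z

theorem pairing_le_add {p k x y : ℕ} (hk : k < 3) (h : pairing p k x y) : x ≤ y + 4 := by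
  rcases (by omega : k = 0 ∨ k = 1 ∨ k = 2) with rfl | rfl | rfl <;>
  rcases mod_four_cases p with hp | hp | hp | hp <;>
  simp only [pairing, lowPair, highPair, hp] at h <;> omega

set_option linter.unusedSimpArgs false in
-- Here `y = p + t`, `x = y + d`, and `s` is the mirror image of `x`; the partner of `y` is `x + e +
-- 1`, and `hv` places that of `x` above `y`. Measuring from `p` removes the truncated subtractions
-- from `highPair`. The lemmas for `k = 1, 2` use the same coordinates.
theorem lowPair_zero_of_stuck {p t d e w s : ℕ} (hd : d = 1 ∨ d = 2 ∨ d = 3)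
    (hs : s + t + d = p + 1) (hne : 2 * t + d ≠ 1)
    (h0 : ¬ highPair p 0 (p + t + d) (p + t))
    (hu : highPair p 0 (p + t + d + (e + 1)) (p + t))
    (hv : highPair p 0 (p + t + d) (p + t + w + 1) ∨
      highPair p 0 (p + t + d + w) (p + t + d)) : lowPair 0 (s + d) s := by
  rcases hd with rfl | rfl | rfl <;>
  rcases mod_four_cases p with hp | hp | hp | hp <;>
  simp only [lowPair, highPair, hp, Nat.add_assoc, Nat.add_sub_cancel_left,
    Nat.add_sub_add_left, Nat.add_left_cancel_iff, Nat.add_le_add_iff_left, Nat.add_eq_left,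
    Nat.left_eq_add, Nat.add_eq_zero_iff, Nat.le_add_right, Nat.reduceEqDiff, Nat.reduceAdd,
    true_and, and_true, false_and, and_false, false_or, or_false, true_or, or_true,
    not_true_eq_false, not_false_eq_true] at hu hv h0 ⊢ <;>
  omega

set_option linter.unusedSimpArgs false in
-- High pairs of value `0` have `y ≥ p`, and low ones have gap `1`, which leaves no room for `x`
-- below the partner of `y`.
theorem false_of_stuck_zero {p y d e : ℕ} (hd : d = 1 ∨ d = 2 ∨ d = 3)
    (hy : y < p) (hne : 2 * y + d ≠ 2 * p + 1)
    (h0 : ¬ pairing p 0 (y + d) y)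
    (hu : pairing p 0 (y + d + (e + 1)) y) : False := by
  rcases hd with rfl | rfl | rfl <;>
  rcases mod_four_cases p with hp | hp | hp | hp <;>
  simp only [pairing, lowPair, highPair, hp, hy.not_ge, Nat.add_assoc, Nat.add_sub_cancel_left,
    Nat.add_sub_add_left, Nat.add_left_cancel_iff, Nat.add_le_add_iff_left, Nat.add_eq_left,
    Nat.left_eq_add, Nat.add_eq_zero_iff, Nat.le_add_right, Nat.reduceEqDiff, Nat.reduceAdd,
    true_and, and_true, false_and, and_false, false_or, or_false, true_or, or_true,
    not_true_eq_false, not_false_eq_true] at hu h0 ⊢ <;>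
  omega

set_option linter.unusedSimpArgs false in
theorem lowPair_one_of_stuck {p t d e w s : ℕ} (hd : d = 1 ∨ d = 2 ∨ d = 3)
    (hs : s + t + d = p + 1) (hne : 2 * t + d ≠ 1)
    (h0 : ¬ highPair p 0 (p + t + d) (p + t))
    (h1 : ¬ highPair p 1 (p + t + d) (p + t))
    (hu : highPair p 1 (p + t + d + (e + 1)) (p + t))
    (hv : highPair p 1 (p + t + d) (p + t + w + 1) ∨
      highPair p 1 (p + t + d + w) (p + t + d)) : lowPair 1 (s + d) s := by
  rcases hd with rfl | rfl | rfl <;>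
  rcases mod_four_cases p with hp | hp | hp | hp <;>
  simp only [lowPair, highPair, hp, Nat.add_assoc, Nat.add_sub_cancel_left,
    Nat.add_sub_add_left, Nat.add_left_cancel_iff, Nat.add_le_add_iff_left, Nat.add_eq_left,
    Nat.left_eq_add, Nat.add_eq_zero_iff, Nat.le_add_right, Nat.reduceEqDiff, Nat.reduceAdd,
    true_and, and_true, false_and, and_false, false_or, or_false, true_or, or_true,
    not_true_eq_false, not_false_eq_true] at hu hv h0 h1 ⊢ <;>
  omega

set_option linter.unusedSimpArgs false in
-- The partner of `y` must be `y + 2`, so `x = y + 1`. If `y % 4 = 0`, this is a pair of value `0`;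
-- if `y % 4 = 1`, the partner of `x` is `y - 1`, against `hv`.
theorem false_of_stuck_one {p y d e w : ℕ} (hd : d = 1 ∨ d = 2 ∨ d = 3)
    (hy : y < p) (hne : 2 * y + d ≠ 2 * p + 1)
    (h0 : ¬ pairing p 0 (y + d) y)
    (h1 : ¬ pairing p 1 (y + d) y)
    (hu : pairing p 1 (y + d + (e + 1)) y)
    (hv : pairing p 1 (y + d) (y + w + 1) ∨ pairing p 1 (y + d + w) (y + d)) : False := by
  rcases hd with rfl | rfl | rfl <;>
  rcases mod_four_cases p with hp | hp | hp | hp <;>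
  simp only [pairing, lowPair, highPair, hp, hy.not_ge, Nat.add_assoc, Nat.add_sub_cancel_left,
    Nat.add_sub_add_left, Nat.add_left_cancel_iff, Nat.add_le_add_iff_left, Nat.add_eq_left,
    Nat.left_eq_add, Nat.add_eq_zero_iff, Nat.le_add_right, Nat.reduceEqDiff, Nat.reduceAdd,
    true_and, and_true, false_and, and_false, false_or, or_false, true_or, or_true,
    not_true_eq_false, not_false_eq_true] at hu hv h0 h1 ⊢ <;>
  omega

set_option linter.unusedSimpArgs false in
set_option maxHeartbeats 2000000 in
theorem lowPair_two_of_stuck {p t d e w s : ℕ} (hd : d = 1 ∨ d = 2 ∨ d = 3)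
    (hs : s + t + d = p + 1) (hne : 2 * t + d ≠ 1)
    (h0 : ¬ highPair p 0 (p + t + d) (p + t))
    (h1 : ¬ highPair p 1 (p + t + d) (p + t))
    (h2 : ¬ highPair p 2 (p + t + d) (p + t))
    (hu : highPair p 2 (p + t + d + (e + 1)) (p + t))
    (hv : highPair p 2 (p + t + d) (p + t + w + 1) ∨
      highPair p 2 (p + t + d + w) (p + t + d)) : lowPair 2 (s + d) s := by
  rcases hd with rfl | rfl | rfl <;>
  rcases mod_four_cases p with hp | hp | hp | hp <;>
  simp only [lowPair, highPair, hp, Nat.add_assoc, Nat.add_sub_cancel_left,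
    Nat.add_sub_add_left, Nat.add_left_cancel_iff, Nat.add_le_add_iff_left, Nat.add_eq_left,
    Nat.left_eq_add, Nat.add_eq_zero_iff, Nat.le_add_right, Nat.reduceEqDiff, Nat.reduceAdd,
    true_and, and_true, false_and, and_false, false_or, or_false, true_or, or_true,
    not_true_eq_false, not_false_eq_true] at hu hv h0 h1 h2 ⊢ <;>
  omega

set_option linter.unusedSimpArgs false in
set_option maxHeartbeats 2000000 in
-- If the partner of `y` is `y + 3`, then `y % 4 = 0` and `x` is `y + 1` or `y + 2`, giving a pair
-- of value `0` or `1`. The one high pair with `y < p` is `(p + 3, p - 1)`, for `p % 4 = 1`; it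
-- leaves in addition `x = p + 2`, excluded by `hne`.
theorem false_of_stuck_two {p y d e : ℕ} (hd : d = 1 ∨ d = 2 ∨ d = 3)
    (hy : y < p) (hne : 2 * y + d ≠ 2 * p + 1)
    (h0 : ¬ pairing p 0 (y + d) y)
    (h1 : ¬ pairing p 1 (y + d) y)
    (h2 : ¬ pairing p 2 (y + d) y)
    (hu : pairing p 2 (y + d + (e + 1)) y) : False := by
  rcases hd with rfl | rfl | rfl <;>
  rcases mod_four_cases p with hp | hp | hp | hp <;>
  simp only [pairing, lowPair, highPair, hp, hy.not_ge, Nat.add_assoc, Nat.add_sub_cancel_left,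
    Nat.add_sub_add_left, Nat.add_left_cancel_iff, Nat.add_le_add_iff_left, Nat.add_eq_left,
    Nat.left_eq_add, Nat.add_eq_zero_iff, Nat.le_add_right, Nat.reduceEqDiff, Nat.reduceAdd,
    true_and, and_true, false_and, and_false, false_or, or_false, true_or, or_true,
    not_true_eq_false, not_false_eq_true] at hu h0 h1 h2 ⊢ <;>
  omega

theorem pairing_iff_highPair {p k x y : ℕ} (h : 2 * p + 1 < x + y) :
    pairing p k x y ↔ highPair p k x y := by
  simp [pairing, h, h.not_gt]

theorem pairing_iff_lowPair {p k x y : ℕ} (h : x + y < 2 * p + 1) :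
    pairing p k x y ↔ lowPair k x y := by
  simp [pairing, h, h.not_gt]

theorem add_ne_of_pairing {p k x y : ℕ} (h : pairing p k x y) : x + y ≠ 2 * p + 1 := by
  rcases h with ⟨h, -⟩ | ⟨h, -⟩
  · exact h.ne
  · exact h.ne.symm

/-- If neither bead can be lowered to the partner of the other one, then the reflected position is
a pair of the same kind. -/
theorem pairing_reflect_of_stuck {p k x y u v : ℕ} (hk : k < 3) (hyx : y < x)
    (hx : x ≤ 2 * p + 1) (hs : x + y ≠ 2 * p + 1) (hno : ∀ j ≤ k, ¬ pairing p j x y)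
    (hu : pairing p k u y) (hxu : x < u)
    (hv : (pairing p k x v ∧ y < v) ∨ pairing p k v x) :
    2 * p + 1 < x + y ∧ pairing p k (2 * p + 1 - y) (2 * p + 1 - x) := by
  obtain ⟨d, rfl⟩ : ∃ d, x = y + d := ⟨x - y, by omega⟩
  have hle := pairing_le_add hk hu
  -- The bead `x` lies strictly between `y` and `u ≤ y + 4`.
  have hd : d = 1 ∨ d = 2 ∨ d = 3 := by omega
  obtain ⟨e, rfl⟩ : ∃ e, u = y + d + (e + 1) := ⟨u - (y + d + 1), by omega⟩
  obtain ⟨w, hv⟩ : ∃ w, pairing p k (y + d) (y + w + 1) ∨ pairing p k (y + d + w) (y + d) := by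
    rcases hv with ⟨hv, hyv⟩ | hv
    · refine ⟨v - (y + 1), Or.inl ?_⟩
      rwa [show y + (v - (y + 1)) + 1 = v by omega]
    · have := pairing_lt hv
      refine ⟨v - (y + d), Or.inr ?_⟩
      rwa [show y + d + (v - (y + d)) = v by omega]
  rcases lt_or_ge y p with hy | hy
  · exfalso
    rcases (by omega : k = 0 ∨ k = 1 ∨ k = 2) with rfl | rfl | rfl
    · exact false_of_stuck_zero hd hy (by omega) (hno 0 le_rfl) hu
    · exact false_of_stuck_one hd hy (by omega) (hno 0 zero_le_one) (hno 1 le_rfl) hu hv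
    · exact false_of_stuck_two hd hy (by omega) (hno 0 zero_le_two) (hno 1 one_le_two)
        (hno 2 le_rfl) hu
  -- From `p ≤ y < x` and `hs` the sum exceeds `2 * p + 1`, so only high pairs occur and the
  -- reflection is a legal move.
  · obtain ⟨t, rfl⟩ : ∃ t, y = p + t := ⟨y - p, by omega⟩
    obtain ⟨s, hst⟩ : ∃ s, s + t + d = p + 1 := ⟨p + 1 - (t + d), by omega⟩
    have hno' : ∀ j ≤ k, ¬ highPair p j (p + t + d) (p + t) := fun j hj =>
      (pairing_iff_highPair (by omega)).not.1 (hno j hj)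
    rw [pairing_iff_highPair (by omega)] at hu
    rw [pairing_iff_highPair (by omega), pairing_iff_highPair (by omega)] at hv
    refine ⟨by omega, ?_⟩
    rw [pairing_iff_lowPair (by omega), show 2 * p + 1 - (p + t) = s + d by omega,
      show 2 * p + 1 - (p + t + d) = s by omega]
    rcases (by omega : k = 0 ∨ k = 1 ∨ k = 2) with rfl | rfl | rfl
    · exact lowPair_zero_of_stuck hd hst (by omega) (hno' 0 le_rfl) hu hv
    · exact lowPair_one_of_stuck hd hst (by omega) (hno' 0 zero_le_one) (hno' 1 le_rfl) hu hv
    · exact lowPair_two_of_stuck hd hst (by omega) (hno' 0 zero_le_two) (hno' 1 one_le_two)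
        (hno' 2 le_rfl) hu hv

/-! ### Grundy values on the set of positions -/

/-- The diagrams in the rectangle with two rows and `2 * p` columns that do not have exactly
`2 * p` boxes. -/
def positions (p : ℕ) : Set YoungDiagram :=
  {Y | Y ≤ rect 2 (2 * p)} \ {Y | Y ≤ rect 2 (2 * p) ∧ Y.rowLen 0 + Y.rowLen 1 = 2 * p}

theorem beads_mem_positions {p x y : ℕ} (hx : x ≤ 2 * p + 1) (hy : y ≤ 2 * p + 1) (hxy : x ≠ y)
    (hs : x + y ≠ 2 * p + 1) : beads x y ∈ positions p := by
  refine ⟨beads_le_rect_of_ne hxy hx hy, fun h => hs ?_⟩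
  rw [← rowLen_add_beads hxy, h.2]

theorem exists_eq_beads_of_mem_positions {p : ℕ} {Y : YoungDiagram} (hY : Y ∈ positions p) :
    ∃ x y, y < x ∧ x ≤ 2 * p + 1 ∧ x + y ≠ 2 * p + 1 ∧ Y = beads x y := by
  obtain ⟨x, y, h1, h2, rfl⟩ := exists_eq_beads hY.1
  refine ⟨x, y, h1, h2, fun h => hY.2 ⟨hY.1, ?_⟩, rfl⟩
  have := rowLen_add_beads h1.ne'
  omega

theorem mem_positions_of_move {p : ℕ} {Y Z : YoungDiagram} (hY : Y ∈ positions p)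
    (h : (MHRGRect 2 (2 * p)).move Y Z) : Z ∈ positions p := by
  obtain ⟨x, y, hyx, hx, hs, rfl⟩ := exists_eq_beads_of_mem_positions hY
  rw [move_beads_iff hx (by omega) hyx.ne' hs] at h
  rcases h with ⟨w, h1, h2, h3, rfl⟩ | ⟨w, h1, h2, h3, rfl⟩ | ⟨h, rfl⟩
  · exact beads_mem_positions (by omega) (by omega) h2 h3
  · exact beads_mem_positions (by omega) (by omega) h2 h3
  · exact beads_mem_positions (by omega) (by omega) (by omega) (by omega)

/-- The position `Y` is one of the pairs for the value `k`. -/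
def IsPaired (p k : ℕ) (Y : YoungDiagram) : Prop := pairing p k (Y.rowLen 0 + 1) (Y.rowLen 1)

theorem isPaired_beads {p k x y : ℕ} (h : y < x) : IsPaired p k (beads x y) ↔ pairing p k x y := by
  rw [IsPaired, rowLen_zero_beads h, rowLen_one_beads h, Nat.sub_add_cancel (by omega)]

/-- Lowering one bead keeps the other, whose partner is unique; reflections are excluded by
`pairing_reflect`. -/
theorem not_isPaired_of_move {p k : ℕ} (hk : k < 3) {Y Z : YoungDiagram} (hY : Y ∈ positions p)
    (hQ : IsPaired p k Y) (h : (MHRGRect 2 (2 * p)).move Y Z) : ¬ IsPaired p k Z := by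
  obtain ⟨x, y, hyx, hx, hs, rfl⟩ := exists_eq_beads_of_mem_positions hY
  rw [move_beads_iff hx (by omega) hyx.ne' hs] at h
  rw [isPaired_beads hyx] at hQ
  rcases h with ⟨w, h1, h2, h3, rfl⟩ | ⟨w, h1, h2, h3, rfl⟩ | ⟨h, rfl⟩
  · rcases h2.lt_or_gt with h2 | h2
    · rw [beads_comm, isPaired_beads h2]
      exact not_pairing_of_pairing hk hQ
    · rw [isPaired_beads h2]
      exact fun h => h1.ne (pairing_unique_right hk h hQ)
  · rw [beads_comm, isPaired_beads (by omega)]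
    exact fun h => h1.ne (pairing_unique_left hk h hQ)
  · rw [beads_comm, isPaired_beads (by omega)]
    exact pairing_reflect hk hx h hQ

/-- Lower `x` to the partner `u` of `y` if `u < x`, otherwise `y` to the partner `v` of `x` if `v <
y`. Equality would make the position itself a pair for `k`; if both attempts fail, reflect. -/
theorem exists_move_isPaired {p k : ℕ} (hk : k < 3) {Y : YoungDiagram} (hY : Y ∈ positions p)
    (hno : ∀ j ≤ k, ¬ IsPaired p j Y) :
    ∃ Z, (MHRGRect 2 (2 * p)).move Y Z ∧ IsPaired p k Z := by
  obtain ⟨x, y, hyx, hx, hs, rfl⟩ := exists_eq_beads_of_mem_positions hY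
  simp only [isPaired_beads hyx] at hno
  have hmove := fun Z => move_beads_iff hx (by omega) hyx.ne' hs (Z := Z)
  have reflected : 2 * p + 1 < x + y ∧ pairing p k (2 * p + 1 - y) (2 * p + 1 - x) →
      ∃ Z, (MHRGRect 2 (2 * p)).move (beads x y) Z ∧ IsPaired p k Z := fun ⟨h1, h2⟩ =>
    ⟨_, (hmove _).2 (Or.inr (Or.inr ⟨h1, beads_comm _ _⟩)), (isPaired_beads (by omega)).2 h2⟩
  obtain ⟨u, hu | hu⟩ := exists_partner hk p y
  · have huy := pairing_lt hu
    exact ⟨_, (hmove _).2 (Or.inl ⟨u, by omega, by omega,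
      add_comm y u ▸ add_ne_of_pairing hu, beads_comm _ _⟩), (isPaired_beads huy).2 hu⟩
  have hyu := pairing_lt hu
  rcases lt_trichotomy u x with hux | rfl | hxu
  · exact ⟨_, (hmove _).2 (Or.inl ⟨u, hux, hyu.ne', add_ne_of_pairing hu, rfl⟩),
      (isPaired_beads hyu).2 hu⟩
  · exact absurd hu (hno k le_rfl)
  obtain ⟨v, hv | hv⟩ := exists_partner hk p x
  · have hvx := pairing_lt hv
    rcases lt_trichotomy v y with hvy | rfl | hyv
    · exact ⟨_, (hmove _).2 (Or.inr (Or.inl ⟨v, hvy, hvx.ne,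
        add_comm x v ▸ add_ne_of_pairing hv, beads_comm _ _⟩)), (isPaired_beads hvx).2 hv⟩
    · exact absurd hv (hno k le_rfl)
    · exact reflected (pairing_reflect_of_stuck hk hyx hx hs hno hu hxu (Or.inl ⟨hv, hyv⟩))
  · exact reflected (pairing_reflect_of_stuck hk hyx hx hs hno hu hxu (Or.inr hv))

theorem grundy_eq_iff_isPaired {p k : ℕ} (hk : k < 3) {Y : YoungDiagram} (hY : Y ∈ positions p) :
    (MHRGRect 2 (2 * p)).grundy Y = k ↔ IsPaired p k Y :=
  ImpartialGame.grundy_eq_iff_of_local _ (positions p) 3 (IsPaired p)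
    (fun _ hY _ h => mem_positions_of_move hY h)
    (fun _ _ _ _ hjk hk h => pairing_disjoint hjk hk h)
    (fun _ hY _ hk hQ _ h => not_isPaired_of_move hk hY hQ h)
    (fun _ hY _ hk hno => exists_move_isPaired hk hY hno) Y hY k hk

/-! ### Options, Sato–Welter values and reachability -/

theorem options_of_lt {p : ℕ} {Y : YoungDiagram} (hY : Y ≤ rect 2 (2 * p))
    (hs : Y.rowLen 0 + Y.rowLen 1 < 2 * p) :
    (MHRGRect 2 (2 * p)).options Y = Y.hookRemovals := by
  obtain ⟨x, y, hyx, hx, rfl⟩ := exists_eq_beads hY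
  have hsum := rowLen_add_beads hyx.ne'
  ext Z
  rw [mem_hookRemovals_beads hyx.ne', ImpartialGame.options, Set.mem_ofPred_eq,
    move_beads_iff hx (by omega) hyx.ne' (by omega)]
  constructor
  · rintro (⟨w, h1, h2, -, h4⟩ | ⟨w, h1, h2, -, h4⟩ | ⟨h, -⟩)
    · exact Or.inl ⟨w, h1, h2, h4⟩
    · exact Or.inr ⟨w, h1, h2, h4⟩
    · omega
  · rintro (⟨w, h1, h2, h4⟩ | ⟨w, h1, h2, h4⟩)
    · exact Or.inl ⟨w, h1, h2, by omega, h4⟩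
    · exact Or.inr (Or.inl ⟨w, h1, h2, by omega, h4⟩)

theorem options_of_gt {p : ℕ} {Y : YoungDiagram} (hY : Y ≤ rect 2 (2 * p))
    (hs : 2 * p < Y.rowLen 0 + Y.rowLen 1) :
    (MHRGRect 2 (2 * p)).options Y =
      (Y.hookRemovals \ {Z | Z ≤ rect 2 (2 * p) ∧ Z.rowLen 0 + Z.rowLen 1 = 2 * p}) ∪
        {Y.reflect (2 * p)} := by
  obtain ⟨x, y, hyx, hx, rfl⟩ := exists_eq_beads hY
  have hsum := rowLen_add_beads hyx.ne'
  have hdiag : ∀ {w z : ℕ}, w ≤ 2 * p + 1 → z ≤ 2 * p + 1 → w ≠ z →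
      (beads w z ∉ {Z | Z ≤ rect 2 (2 * p) ∧ Z.rowLen 0 + Z.rowLen 1 = 2 * p} ↔
        w + z ≠ 2 * p + 1) := by
    intro w z hw hz hwz
    rw [Set.mem_ofPred_eq, ← rowLen_add_beads hwz]
    simp [beads_le_rect_of_ne hwz hw hz]
  ext Z
  rw [Set.mem_union, Set.mem_sdiff, mem_hookRemovals_beads hyx.ne', Set.mem_singleton_iff,
    reflect_beads hyx hx, ImpartialGame.options, Set.mem_ofPred_eq,
    move_beads_iff hx (by omega) hyx.ne' (by omega)]
  constructor
  · rintro (⟨w, h1, h2, h3, rfl⟩ | ⟨w, h1, h2, h3, rfl⟩ | ⟨-, h⟩)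
    · exact Or.inl ⟨Or.inl ⟨w, h1, h2, rfl⟩, (hdiag (by omega) (by omega) h2).2 h3⟩
    · exact Or.inl ⟨Or.inr ⟨w, h1, h2, rfl⟩, (hdiag (by omega) (by omega) h2).2 h3⟩
    · exact Or.inr h
  · rintro (⟨⟨w, h1, h2, rfl⟩ | ⟨w, h1, h2, rfl⟩, h⟩ | h)
    · exact Or.inl ⟨w, h1, h2, (hdiag (by omega) (by omega) h2).1 h, rfl⟩
    · exact Or.inr (Or.inl ⟨w, h1, h2, (hdiag (by omega) (by omega) h2).1 h, rfl⟩)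
    · exact Or.inr (Or.inr ⟨by omega, h⟩)

theorem rowLen_mono {Y Z : YoungDiagram} (h : Z ≤ Y) (i : ℕ) : Z.rowLen i ≤ Y.rowLen i := by
  by_contra! hlt
  exact lt_irrefl _ (mem_iff_lt_rowLen.1 (h (mem_iff_lt_rowLen.2 hlt)))

/-- The region below the middle is closed under removing hooks, and there both games have the same
options. -/
theorem grundy_eq_hrg_of_lt {p : ℕ} (Y : YoungDiagram) (hY : Y ≤ rect 2 (2 * p))
    (hs : Y.rowLen 0 + Y.rowLen 1 < 2 * p) :
    (MHRGRect 2 (2 * p)).grundy Y = HRG.grundy Y := by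
  induction Y using HRG.wf.induction with
  | _ Y ih =>
  rw [ImpartialGame.grundy_eq, ImpartialGame.grundy_eq HRG, options_of_lt hY hs]
  refine congrArg _ (Set.image_congr fun Z hZ => ?_)
  have hle : Z ≤ Y := by
    obtain ⟨c, -, rfl⟩ := hZ
    exact Y.removeHook_le c
  have h0 := rowLen_mono hle 0
  have h1 := rowLen_mono hle 1
  exact ih Z hZ (hle.trans hY) (by omega)

theorem rect_eq_beads (n : ℕ) : rect 2 n = beads (n + 1) n := by
  ext c
  rw [mem_cells, mem_cells, mem_rect, mem_beads (by omega)]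
  omega

/-- Lower the smaller bead first and then the larger one: the sum stays above `2 * p + 1`, so each
turn is a single hook. -/
theorem reachable_beads_of_gt {p x y : ℕ} (hp : 1 ≤ p) (hyx : y < x) (hx : x ≤ 2 * p + 1)
    (hs : 2 * p + 1 < x + y) :
    Relation.ReflTransGen (MHRGRect 2 (2 * p)).move (rect 2 (2 * p)) (beads x y) := by
  rw [rect_eq_beads]
  have h1 : Relation.ReflTransGen (MHRGRect 2 (2 * p)).move (beads (2 * p + 1) (2 * p))
      (beads (2 * p + 1) y) := by
    rcases (by omega : y = 2 * p ∨ y < 2 * p) with rfl | hy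
    · exact .refl
    · refine .single ((move_beads_iff le_rfl (by omega) (by omega) (by omega)).2
        (Or.inr (Or.inl ⟨y, hy, by omega, by omega, beads_comm _ _⟩)))
  rcases hx.eq_or_lt with rfl | hx
  · exact h1
  · exact h1.tail ((move_beads_iff le_rfl (by omega) (by omega) (by omega)).2
      (Or.inl ⟨x, hx, hyx.ne', hs.ne', rfl⟩))

theorem reachable_rect {p : ℕ} (hp : 1 ≤ p) :
    (MHRGRect 2 (2 * p)).reachable (rect 2 (2 * p)) = positions p := by
  ext Y
  constructor
  · intro h
    induction (show Relation.ReflTransGen _ _ _ from h) with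
    | refl =>
      rw [rect_eq_beads]
      exact beads_mem_positions le_rfl (by omega) (by omega) (by omega)
    | tail _ hm ih => exact mem_positions_of_move (ih ‹_›) hm
  · intro hY
    obtain ⟨x, y, hyx, hx, hs, rfl⟩ := exists_eq_beads_of_mem_positions hY
    rcases hs.lt_or_gt with hs | hs
    -- A position below the middle is the reflection of one above it, hence one more move away.
    · refine (reachable_beads_of_gt hp (x := 2 * p + 1 - y) (y := 2 * p + 1 - x)
        (by omega) (by omega) (by omega)).tail ?_
      refine (move_beads_iff (by omega) (by omega) (by omega) (by omega)).2
        (Or.inr (Or.inr ⟨by omega, ?_⟩))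
      rw [beads_comm]
      congr 1 <;> omega
    · exact reachable_beads_of_gt hp hyx hx hs

end MHRG

theorem theorem4p13 (n' : ℕ) (hn' : 1 ≤ n') :
    (MHRGRect 2 (2 * n')).reachable (rect 2 (2 * n')) =
        {Y | Y ≤ rect 2 (2 * n')} \
          {Y | Y ≤ rect 2 (2 * n') ∧ Y.rowLen 0 + Y.rowLen 1 = 2 * n'} ∧
    (∀ Y : YoungDiagram, Y ≤ rect 2 (2 * n') → Y.rowLen 0 + Y.rowLen 1 < 2 * n' →
      (MHRGRect 2 (2 * n')).options Y = Y.hookRemovals) ∧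
    (∀ Y : YoungDiagram, Y ≤ rect 2 (2 * n') → 2 * n' < Y.rowLen 0 + Y.rowLen 1 →
      (MHRGRect 2 (2 * n')).options Y =
        (Y.hookRemovals \
          {Z | Z ≤ rect 2 (2 * n') ∧ Z.rowLen 0 + Z.rowLen 1 = 2 * n'}) ∪
          {Y.reflect (2 * n')}) ∧
    (∀ Y : YoungDiagram, Y ≤ rect 2 (2 * n') → Y.rowLen 0 + Y.rowLen 1 < 2 * n' →
      (MHRGRect 2 (2 * n')).grundy Y = HRG.grundy Y) ∧
    (∀ Y : YoungDiagram, Y ≤ rect 2 (2 * n') → 2 * n' < Y.rowLen 0 + Y.rowLen 1 →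
      ((MHRGRect 2 (2 * n')).grundy Y = 0 ↔ (Y.rowLen 0, Y.rowLen 1) ∈ table0 n') ∧
      ((MHRGRect 2 (2 * n')).grundy Y = 1 ↔ (Y.rowLen 0, Y.rowLen 1) ∈ table1 n') ∧
      ((MHRGRect 2 (2 * n')).grundy Y = 2 ↔ (Y.rowLen 0, Y.rowLen 1) ∈ table2 n')) := by
  refine ⟨MHRG.reachable_rect hn', fun Y hY hs => MHRG.options_of_lt hY hs,
    fun Y hY hs => MHRG.options_of_gt hY hs, fun Y hY hs => MHRG.grundy_eq_hrg_of_lt Y hY hs,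
    fun Y hY hs => ?_⟩
  have hmem : Y ∈ MHRG.positions n' := ⟨hY, fun h => hs.ne' h.2⟩
  have hlt : Y.rowLen 1 < Y.rowLen 0 + 1 := Nat.lt_succ_of_le (Y.rowLen_anti 0 1 zero_le_one)
  have hgt : 2 * n' + 1 < Y.rowLen 0 + 1 + Y.rowLen 1 := by omega
  refine ⟨?_, ?_, ?_⟩
  · rw [MHRG.grundy_eq_iff_isPaired (by omega) hmem, MHRG.IsPaired,
      MHRG.pairing_iff_highPair hgt, ← mem_table0_iff hlt, Nat.add_sub_cancel]
  · rw [MHRG.grundy_eq_iff_isPaired (by omega) hmem, MHRG.IsPaired,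
      MHRG.pairing_iff_highPair hgt, ← mem_table1_iff hlt, Nat.add_sub_cancel]
  · rw [MHRG.grundy_eq_iff_isPaired (by omega) hmem, MHRG.IsPaired,
      MHRG.pairing_iff_highPair hgt, ← mem_table2_iff hlt, Nat.add_sub_cancel]
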